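/- Let $k>1$ be an integer and let $\beta_0,\beta_1,\ldots,\beta_{2k-3},\beta_{2k}$ be real numbers with $\beta_0>0$. For $x,y\in\mathbb R$ put $\beta(x,y):=(\beta_0,\beta_1,\ldots,\beta_{2k-3},y,x,\beta_{2k})$. **Notation.** For $\gamma=(\gamma_0,\ldots,\gamma_{2m})$ let $A_\gamma=(\gamma_{i+j})_{i,j=0}^m$ be its Hankel matrix, with columns $v_0,\ldots,v_m$. Let $\operatorname{Rank}\gamma=m+1$ if $A_\gamma$ is nonsingular, and otherwise $\operatorname{Rank}\gamma=\min\{i: v_i\in\operatorname{span}\{v_0,\ldots,v_{i-1}\}\}$. Write $A^+$ for the Moore–Penrose inverse of $A$, and for $M=\begin{pmatrix}A&B\\C&D\end{pmatrix}$ write $M/A=D-CA^+B$. A representing measure for $\gamma$ is a positive Borel measure $\mu$ on $\mathbb R$ with finite moments up to order $2m$ and $\gamma_i=\int t^i\,d\mu$ for $0\le i\le 2m$; it is $r$-atomic if it is a combination with positive coefficients of point masses at exactly $r$ distinct points. The partial matrix $A_{\beta(x,y)}$ (with $x,y$ unspecified) is partially positive semidefinite if each of its fully specified principal submatrices is positive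 semidefinite. Let $\widetilde\beta=(\beta_0,\ldots,\beta_{2k-4})$ and $s=(\beta_{k-1},\ldots,\beta_{2k-3})$ and, for $k>2$, let $\widehat\beta=(\beta_0,\ldots,\beta_{2k-6})$, $u=(\beta_k,\ldots,\beta_{2k-3})$, $w=(\beta_{k-2},\ldots,\beta_{2k-5})$ and $$\widetilde A=\begin{pmatrix}A_{\widehat\beta}&u^T\\u&\beta_{2k}\end{pmatrix}.$$ **Theorem.** The following are equivalent: 1. There exist $x_0,y_0\in\mathbb R$ such that $\beta(x_0,y_0)$ has a representing measure. 2. There exist $x_0,y_0\in\mathbb R$ such that $\beta(x_0,y_0)$ has a $(\operatorname{Rank}\widetilde\beta)$-atomic or a $(\operatorname{Rank}\widetilde\beta+1)$-atomic representing measure. 3. $A_{\beta(x,y)}$ is partially positive semidefinite and one of the following holds: - (a) $k=2$ and $\beta_1^2/\beta_0\le\sqrt{\beta_0\beta_4}$; - (b) $k>2$, $$sA_{\widetilde\beta}^+s^T\le uA_{\widehat\beta}^+w^T+\sqrt{(A_{\widetilde\beta}/A_{\widehat\beta})(\widetilde A/A_{\widehat\beta})},$$ and either $A_{\widetilde\beta}\succ0$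 or $\operatorname{rank}A_{\widehat\beta}=\operatorname{rank}A_{\widetilde\beta}=\operatorname{rank}\begin{pmatrix}A_{\widetilde\beta}&s^T\end{pmatrix}=\operatorname{rank}\widetilde A$. Moreover, suppose that some completion $\beta(x_0,y_0)$ has a representing measure. - If $k=2$, then some completion has a $1$-atomic representing measure if and only if $\beta_1^2/\beta_0=\sqrt{\beta_0\beta_4}$; if this equality fails, some completion has a $2$-atomic representing measure. - If $k>2$, then some completion has a $(\operatorname{Rank}\widetilde\beta)$-atomic representing measure if and only if $$sA_{\widetilde\beta}^+s^T=uA_{\widehat\beta}^+w^T-\sqrt{(A_{\widetilde\beta}/A_{\widehat\beta})(\widetilde A/A_{\widehat\beta})}\quad\text{or}\quad sA_{\widetilde\beta}^+s^T=uA_{\widehat\beta}^+w^T+\sqrt{(A_{\widetilde\beta}/A_{\widehat\beta})(\widetilde A/A_{\widehat\beta})};$$ if both equalities fail, some completion has a $(\operatorname{Rank}\widetilde\beta+1)$-atomic representing measure. -/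

import Mathlib

open MeasureTheory

noncomputable section

namespace GapHamburger

/-! ### Moore–Penrose inverse and generalized Schur complement -/

/-- The four Penrose equations: `X` is the Moore–Penrose inverse of the real matrix `A`. -/
structure IsMoorePenrose {m n : Type*} [Fintype m] [Fintype n]
    (A : Matrix m n ℝ) (X : Matrix n m ℝ) : Prop where
  mul_mul_self : A * X * A = A
  mul_mul_inv : X * A * X = X
  symm_left : (A * X).transpose = A * X
  symm_right : (X * A).transpose = X * A

theorem IsMoorePenrose.unique {m n : Type*} [Fintype m] [Fintype n]
    {A : Matrix m n ℝ} {X Y : Matrix n m ℝ}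
    (hX : IsMoorePenrose A X) (hY : IsMoorePenrose A Y) : X = Y := by
  have h1 : A * X = A * Y := by
    calc A * X = (A * Y * A) * X := by rw [hY.mul_mul_self]
      _ = (A * Y).transpose * (A * X).transpose := by
          rw [hY.symm_left, hX.symm_left]; simp only [Matrix.mul_assoc]
      _ = ((A * X * A) * Y).transpose := by
          rw [← Matrix.transpose_mul]; simp only [Matrix.mul_assoc]
      _ = A * Y := by rw [hX.mul_mul_self, hY.symm_left]
  have h2 : X * A = Y * A := by
    calc X * A = X * (A * Y * A) := by rw [hY.mul_mul_self]
      _ = (X * A).transpose * (Y * A).transpose := by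
          rw [hY.symm_right, hX.symm_right]; simp only [Matrix.mul_assoc]
      _ = (Y * (A * X * A)).transpose := by
          rw [← Matrix.transpose_mul]; simp only [Matrix.mul_assoc]
      _ = Y * A := by rw [hX.mul_mul_self, hY.symm_right]
  calc X = X * A * X := hX.mul_mul_inv.symm
    _ = Y * (A * X) := by rw [h2, Matrix.mul_assoc]
    _ = Y := by rw [h1, ← Matrix.mul_assoc, hY.mul_mul_inv]

theorem exists_isMoorePenrose_of_isHermitian {n : Type*} [Fintype n]
    {S : Matrix n n ℝ} (hS : S.IsHermitian) : ∃ X, IsMoorePenrose S X := by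
  classical
  obtain ⟨U, d, hU, hSd⟩ : ∃ (U : Matrix n n ℝ) (d : n → ℝ),
      U.transpose * U = 1 ∧ S = U * Matrix.diagonal d * U.transpose := by
    refine ⟨(hS.eigenvectorUnitary : Matrix n n ℝ), hS.eigenvalues, ?_, ?_⟩
    · have := Unitary.coe_star_mul_self hS.eigenvectorUnitary
      rwa [Matrix.star_eq_conjTranspose, Matrix.conjTranspose_eq_transpose_of_trivial] at this
    · have := hS.spectral_theorem
      rw [Unitary.conjStarAlgAut_apply, Matrix.star_eq_conjTranspose,
        Matrix.conjTranspose_eq_transpose_of_trivial] at this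
      exact this
  have key : ∀ a b : n → ℝ, (U * Matrix.diagonal a * U.transpose) *
      (U * Matrix.diagonal b * U.transpose)
      = U * Matrix.diagonal (fun i => a i * b i) * U.transpose := by
    intro a b
    rw [← Matrix.diagonal_mul_diagonal]
    calc _ = U * Matrix.diagonal a * (U.transpose * U) * (Matrix.diagonal b * U.transpose) := by
          simp only [Matrix.mul_assoc]
      _ = _ := by rw [hU]; simp only [Matrix.mul_assoc, Matrix.one_mul]
  have tr : ∀ a : n → ℝ, (U * Matrix.diagonal a * U.transpose).transpose
      = U * Matrix.diagonal a * U.transpose := by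
    intro a
    simp [Matrix.transpose_mul, Matrix.mul_assoc]
  refine ⟨U * Matrix.diagonal (fun i => (d i)⁻¹) * U.transpose, ?_, ?_, ?_, ?_⟩
  · rw [hSd, key, key]; congr 3; funext i; exact mul_inv_mul_cancel (d i)
  · rw [hSd, key, key]; congr 3; funext i
    simpa using mul_inv_mul_cancel (d i)⁻¹
  · rw [hSd, key, tr]
  · rw [hSd, key, tr]

theorem exists_isMoorePenrose {m n : Type*} [Fintype m] [Fintype n]
    (A : Matrix m n ℝ) : ∃ X, IsMoorePenrose A X := by
  classical
  have hS : (A.transpose * A).IsHermitian := by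
    simpa using Matrix.isHermitian_conjTranspose_mul_self A
  obtain ⟨G, hG⟩ := exists_isMoorePenrose_of_isHermitian hS
  have hA : A * (G * (A.transpose * A)) = A := by
    have h0 : A.transpose * A * (G * (A.transpose * A) - 1) = 0 := by
      rw [Matrix.mul_sub, ← Matrix.mul_assoc, hG.mul_mul_self, Matrix.mul_one, sub_self]
    have h1 : A * (G * (A.transpose * A) - 1) = 0 := by
      have := (Matrix.conjTranspose_mul_self_mul_eq_zero A (G * (A.transpose * A) - 1)).1
      rw [Matrix.conjTranspose_eq_transpose_of_trivial] at this
      exact this h0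
    rw [Matrix.mul_sub, Matrix.mul_one, sub_eq_zero] at h1
    exact h1
  have hGt : IsMoorePenrose (A.transpose * A) G.transpose := by
    have hSt : (A.transpose * A).transpose = A.transpose * A := by simp
    clear hA hS
    generalize A.transpose * A = S at hG hSt
    refine ⟨?_, ?_, ?_, ?_⟩
    · have := congrArg Matrix.transpose hG.mul_mul_self
      rw [Matrix.transpose_mul, Matrix.transpose_mul, hSt] at this
      rwa [Matrix.mul_assoc]
    · have := congrArg Matrix.transpose hG.mul_mul_inv
      rw [Matrix.transpose_mul, Matrix.transpose_mul, hSt] at this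
      rwa [Matrix.mul_assoc]
    · have := hG.symm_right
      rw [Matrix.transpose_mul, hSt] at this
      rw [this, Matrix.transpose_mul, hSt, this]
    · have := hG.symm_left
      rw [Matrix.transpose_mul, hSt] at this
      rw [this, Matrix.transpose_mul, hSt, this]
  have hGs : G.transpose = G := hGt.unique hG
  refine ⟨G * A.transpose, ?_, ?_, ?_, ?_⟩
  · calc A * (G * A.transpose) * A = A * (G * (A.transpose * A)) := by
          simp only [Matrix.mul_assoc]
      _ = A := hA
  · calc G * A.transpose * A * (G * A.transpose)
          = G * (A.transpose * A) * G * A.transpose := by simp only [Matrix.mul_assoc]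
      _ = G * A.transpose := by rw [hG.mul_mul_inv]
  · simp only [Matrix.transpose_mul, Matrix.transpose_transpose, hGs, Matrix.mul_assoc]
  · have := hG.symm_right
    rw [Matrix.mul_assoc, this]

/-- The Moore–Penrose inverse `A⁺` of a real matrix. -/
def pinv {m n : Type*} [Fintype m] [Fintype n] (A : Matrix m n ℝ) : Matrix n m ℝ :=
  Classical.choose (exists_isMoorePenrose A)

theorem isMoorePenrose_pinv {m n : Type*} [Fintype m] [Fintype n] (A : Matrix m n ℝ) :
    IsMoorePenrose A (pinv A) :=
  Classical.choose_spec (exists_isMoorePenrose A)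

/-- The generalized Schur complement `M / A = D - C A⁺ B` of `A` in the block matrix
`M = (A B; C D)`. -/
def schurCompl {m n : Type*} [Fintype m] [Fintype n]
    (M : Matrix (m ⊕ n) (m ⊕ n) ℝ) : Matrix n n ℝ :=
  M.toBlocks₂₂ - M.toBlocks₂₁ * pinv M.toBlocks₁₁ * M.toBlocks₁₂

/-! ### Hankel matrices -/

/-- The `(j+1)`-th column `v_j = (β_j, …, β_{j+m})` of the Hankel matrix of `(β_0, …, β_{2m})`. -/
def hankelCol (β : ℕ → ℝ) (m j : ℕ) : Fin (m + 1) → ℝ := fun l => β (j + l)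

/-- The Hankel matrix `(β_{i+j})_{i,j=0}^m` of the sequence `(β_0, …, β_{2m})`. -/
def hankel (β : ℕ → ℝ) (m : ℕ) : Matrix (Fin (m + 1)) (Fin (m + 1)) ℝ :=
  Matrix.of fun i j => β (i + j)

open Classical in
/-- The rank of the sequence `(β_0, …, β_{2m})`: it is `m + 1` if the Hankel matrix is nonsingular,
and otherwise the least `i` such that column `v_i` lies in the span of `v_0, …, v_{i-1}`. -/
def seqRank (β : ℕ → ℝ) (m : ℕ) : ℕ :=
  if IsUnit (hankel β m) then m + 1
  else sInf {i : ℕ | i ≤ m ∧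
    hankelCol β m i ∈ Submodule.span ℝ (hankelCol β m '' {j | j < i})}

/-! ### Partial matrices -/

/-- A partial matrix: `none` stands for an unspecified entry. It is partially positive semidefinite
if specified entries are symmetric (together with their positions) and every fully specified
principal submatrix is positive semidefinite. -/
def IsPPSD {n : Type*} [Fintype n] (A : Matrix n n (Option ℝ)) : Prop :=
  (∀ i j, A i j = A j i) ∧
  ∀ Q : Finset n, (∀ i ∈ Q, ∀ j ∈ Q, (A i j).isSome) →
    (Matrix.of fun i j : Q => (A i j).getD 0).PosSemidef

/-! ### The sequence with gaps `(β_0, …, β_{2k-3}, y, x, β_{2k})`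

The given data are the entries `β i` with `i ≤ 2 * k - 3` or `i = 2 * k` of a function `β : ℕ → ℝ`;
its other values are never used. -/

/-- The completed sequence `β(x, y)`, with `y` at position `2k-2` and `x` at position `2k-1`. -/
def fillGaps (k : ℕ) (β : ℕ → ℝ) (x y : ℝ) : ℕ → ℝ := fun i =>
  if i = 2 * k - 2 then y else if i = 2 * k - 1 then x else β i

/-- The partial Hankel matrix `A_{β(x,y)}`, with `x` and `y` unspecified. -/
def partialHankel (k : ℕ) (β : ℕ → ℝ) : Matrix (Fin (k + 1)) (Fin (k + 1)) (Option ℝ) :=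
  Matrix.of fun i j =>
    if (i : ℕ) + j = 2 * k - 2 ∨ (i : ℕ) + j = 2 * k - 1 then none else some (β (i + j))

/-- `A_{β̂}` for `β̂ = (β_0, …, β_{2k-6})`; used for `k > 2` only. -/
def Ahat (k : ℕ) (β : ℕ → ℝ) : Matrix (Fin (k - 3 + 1)) (Fin (k - 3 + 1)) ℝ :=
  hankel β (k - 3)

/-- `A_{β̃}` for `β̃ = (β_0, …, β_{2k-4})`. -/
def Atilde (k : ℕ) (β : ℕ → ℝ) : Matrix (Fin (k - 2 + 1)) (Fin (k - 2 + 1)) ℝ :=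
  hankel β (k - 2)

/-- `u = (β_k, …, β_{2k-3})`, for `k > 2`. -/
def uVec (k : ℕ) (β : ℕ → ℝ) : Fin (k - 3 + 1) → ℝ := fun i => β (k + i)

/-- `s = (β_{k-1}, …, β_{2k-3})`. -/
def sVec (k : ℕ) (β : ℕ → ℝ) : Fin (k - 2 + 1) → ℝ := fun i => β (k - 1 + i)

/-- `w = (β_{k-2}, …, β_{2k-5})`, for `k > 2`. -/
def wVec (k : ℕ) (β : ℕ → ℝ) : Fin (k - 3 + 1) → ℝ := fun i => β (k - 2 + i)

/-- The matrix `Ã = (A_{β̂} uᵀ; u β_{2k})`, for `k > 2`. -/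
def Acorner (k : ℕ) (β : ℕ → ℝ) :
    Matrix (Fin (k - 3 + 1) ⊕ Unit) (Fin (k - 3 + 1) ⊕ Unit) ℝ :=
  Matrix.fromBlocks (Ahat k β) (Matrix.replicateCol Unit (uVec k β))
    (Matrix.replicateRow Unit (uVec k β)) (Matrix.of fun _ _ => β (2 * k))

/-- The splitting of the indices `0, …, k-2` of `A_{β̃}` into `0, …, k-3` and `k-2`, for `k > 2`. -/
def splitLast (k : ℕ) : Fin (k - 3 + 1) ⊕ Unit → Fin (k - 2 + 1) :=
  Sum.elim (Fin.castLE (by omega)) (fun _ => Fin.last (k - 2))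

theorem splitLast_bijective {k : ℕ} (hk : 2 < k) : Function.Bijective (splitLast k) := by
  constructor
  · rintro (a | a) (b | b) h <;> simp [splitLast, Fin.ext_iff] at h ⊢ <;> omega
  · intro i
    by_cases hi : (i : ℕ) = k - 2
    · exact ⟨Sum.inr (), by simp [splitLast, Fin.ext_iff, hi]⟩
    · exact ⟨Sum.inl ⟨i, by omega⟩, by simp [splitLast]⟩

/-- The Schur complement `A_{β̃} / A_{β̂}`, a real number; `A_{β̂}` is the upper left block. -/
def schurTilde (k : ℕ) (β : ℕ → ℝ) : ℝ :=
  schurCompl ((Atilde k β).submatrix (splitLast k) (splitLast k)) () ()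

/-- The Schur complement `Ã / A_{β̂}`, a real number. -/
def schurCorner (k : ℕ) (β : ℕ → ℝ) : ℝ := schurCompl (Acorner k β) () ()

/-- Sanity check: in block form `A_{β̃} = (A_{β̂} wᵀ; w β_{2k-4})`. -/
theorem Atilde_eq_fromBlocks {k : ℕ} (hk : 2 < k) (β : ℕ → ℝ) :
    (Atilde k β).submatrix (splitLast k) (splitLast k) =
      Matrix.fromBlocks (Ahat k β) (Matrix.replicateCol Unit (wVec k β))
        (Matrix.replicateRow Unit (wVec k β)) (Matrix.of fun _ _ => β (2 * k - 4)) := by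
  ext (i | i) (j | j) <;> simp [Atilde, Ahat, hankel, splitLast, wVec]
  · rw [add_comm]
  · congr 1; omega

/-- The number `s A_{β̃}⁺ sᵀ`. -/
def sTerm (k : ℕ) (β : ℕ → ℝ) : ℝ :=
  dotProduct (sVec k β) ((pinv (Atilde k β)).mulVec (sVec k β))

/-- The number `u A_{β̂}⁺ wᵀ`. -/
def uwTerm (k : ℕ) (β : ℕ → ℝ) : ℝ :=
  dotProduct (uVec k β) ((pinv (Ahat k β)).mulVec (wVec k β))

/-! ### Representing measures on the real line -/

/-- `μ` is a representing measure on `ℝ` for `(γ_0, …, γ_{2k})`. -/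
def Represents (μ : Measure ℝ) (k : ℕ) (γ : ℕ → ℝ) : Prop :=
  ∀ i ≤ 2 * k, Integrable (fun t : ℝ => t ^ i) μ ∧ ∫ t, t ^ i ∂μ = γ i

/-- `μ` is `r`-atomic: a combination of point masses at exactly `r` distinct points, with positive
weights. -/
def IsAtomicMeasure (r : ℕ) (μ : Measure ℝ) : Prop :=
  ∃ (S : Finset ℝ) (c : ℝ → ℝ), S.card = r ∧ (∀ t ∈ S, 0 < c t) ∧
    μ = ∑ t ∈ S, ENNReal.ofReal (c t) • Measure.dirac t

/-- Some completion `β(x₀, y₀)` of the sequence with gaps has a representing measure on `ℝ`. -/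
def HasMeasure (k : ℕ) (β : ℕ → ℝ) : Prop :=
  ∃ x₀ y₀ : ℝ, ∃ μ : Measure ℝ, Represents μ k (fillGaps k β x₀ y₀)

/-- Some completion `β(x₀, y₀)` of the sequence with gaps has an `r`-atomic representing measure. -/
def HasAtomicMeasure (r k : ℕ) (β : ℕ → ℝ) : Prop :=
  ∃ x₀ y₀ : ℝ, ∃ μ : Measure ℝ, IsAtomicMeasure r μ ∧ Represents μ k (fillGaps k β x₀ y₀)

end GapHamburger

end

open GapHamburger

/-!
The moment functional `L` of a sequence `γ` is `X ^ i ↦ γ i`, and the Hankel matrix is the Gram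
matrix of `(f, g) ↦ L (f g)`. A sequence is finitely atomic as soon as it satisfies a recursion `p`
such that the form is positive definite below the degree of `p`: then `p` is an orthogonal
polynomial, so its roots are real and simple, and Gauss quadrature (`exists_quadrature`) yields the
measure. The whole proof consists in finding such a recursion for a suitable choice of `x`, `y`.

Suppose `A_{β̃}` is positive definite. Orthogonalizing `X ^ (k-1)` against lower degrees gives `p₀`
with `⟨p₀, p₀⟩ = y - S`, where `S = s A_{β̃}⁺ sᵀ`. Orthogonalizing `X ^ (k-2)` and `X ^ k` against
degrees below `k - 2` gives `p₁`, `p₂` with Gram matrix `(σ, y - m; y - m, τ)`, where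
`m = u A_{β̂}⁺ wᵀ` and `σ`, `τ` are the two Schur complements (`gapData_of_posOn`; for `k = 2` the
same data are written down by hand in `gapData_two`). Positivity of both forces
`S ≤ y ≤ m + √(σ τ)`. Conversely, take `y = m + √(σ τ)`: a combination of `p₁` and `p₂` becomes
orthogonal to `X ^ k` and all degrees below `k - 1`, and `x` can be chosen to make it orthogonal to
`X ^ (k-1)` too. If `S < y`, it is the wanted recursion of degree `k`. If `S = y`, or more generally
if `S = m ± √(σ τ)` and `y = S`, that combination is a multiple of `p₀`, which is then a recursion
of degree `k - 1`. A `(k - 1)`-atomic measure must have its atoms at the zeros of `p₀`, so these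
equalities are also necessary.

Suppose `A_{β̃}` is singular. A representing measure is then supported on the zeros of a polynomial
of degree at most `k - 2`; with `r` atoms, all four ranks equal `r`, and `p₀`, `p₁` vanish on the
atoms, so that `S = y = m` and `σ = 0` (`singular_of_hasMeasure`). Conversely, the rank conditions
say exactly that `σ = τ = 0` and that `p₀`, `p₁`, `p₂` exist. The minimal recursion `p` of `β̃`
divides `p₁` and `p₂`, and through these multiples it extends to a recursion for all of the given
data (`GapData.hasAtomicMeasure_of_singular`).
-/

open MeasureTheory
open GapHamburger
open Polynomial

namespace GapHamburger

noncomputable section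

/-! ### The moment functional -/

/-- The moment functional (Riesz functional) of a sequence `γ`: the linear functional on `ℝ[X]`
with `X ^ i ↦ γ i`. -/
def moment (γ : ℕ → ℝ) : ℝ[X] →ₗ[ℝ] ℝ := (Polynomial.basisMonomials ℝ).constr ℝ γ

theorem moment_X_pow (γ : ℕ → ℝ) (i : ℕ) : moment γ (X ^ i) = γ i := by
  have := (Polynomial.basisMonomials ℝ).constr_basis ℝ γ i
  rw [Polynomial.coe_basisMonomials] at this
  rwa [X_pow_eq_monomial]

theorem moment_C_mul (γ : ℕ → ℝ) (a : ℝ) (f : ℝ[X]) : moment γ (C a * f) = a * moment γ f := by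
  rw [← smul_eq_C_mul, map_smul, smul_eq_mul]

theorem moment_eq_sum (γ : ℕ → ℝ) {f : ℝ[X]} {n : ℕ} (hf : f.natDegree < n) :
    moment γ f = ∑ i ∈ Finset.range n, f.coeff i * γ i := by
  conv_lhs => rw [f.as_sum_range' n hf]
  simp only [map_sum, ← C_mul_X_pow_eq_monomial, moment_C_mul, moment_X_pow]

theorem moment_congr {γ γ' : ℕ → ℝ} {f : ℝ[X]} (h : ∀ i ≤ f.natDegree, γ i = γ' i) :
    moment γ f = moment γ' f := by
  rw [moment_eq_sum γ (Nat.lt_succ_self _), moment_eq_sum γ' (Nat.lt_succ_self _)]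
  exact Finset.sum_congr rfl fun i hi => by
    rw [h i (Nat.lt_succ_iff.1 (Finset.mem_range.1 hi))]

/-- If two linear functionals agree on the monomials of degree below `n`, they agree on all
polynomials of degree below `n`. -/
theorem linear_eq_of_X_pow {φ ψ : ℝ[X] →ₗ[ℝ] ℝ} {n : ℕ} (h : ∀ j < n, φ (X ^ j) = ψ (X ^ j))
    {f : ℝ[X]} (hf : f.degree < n) : φ f = ψ f := by
  by_cases h0 : f = 0
  · simp [h0]
  have hn : f.natDegree < n := (natDegree_lt_iff_degree_lt h0).2 hf
  rw [f.as_sum_range' n hn]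
  simp only [map_sum, ← C_mul_X_pow_eq_monomial, ← smul_eq_C_mul, map_smul]
  exact Finset.sum_congr rfl fun i hi => by rw [h i (Finset.mem_range.1 hi)]

theorem moment_mul_eq_zero {γ : ℕ → ℝ} {p f : ℝ[X]} {n : ℕ}
    (h : ∀ j < n, moment γ (p * X ^ j) = 0) (hf : f.degree < n) : moment γ (p * f) = 0 := by
  have := linear_eq_of_X_pow (φ := moment γ ∘ₗ LinearMap.mulLeft ℝ p) (ψ := 0) (n := n)
    (by simpa using h) hf
  simpa using this

/-- The Hankel form of `γ` is positive definite on polynomials of degree less than `n`. -/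
def PosOn (γ : ℕ → ℝ) (n : ℕ) : Prop :=
  ∀ f : ℝ[X], f.degree < n → f ≠ 0 → 0 < moment γ (f * f)

theorem PosOn.mono {γ : ℕ → ℝ} {m n : ℕ} (h : PosOn γ n) (hmn : m ≤ n) : PosOn γ m :=
  fun f hf => h f (hf.trans_le (by exact_mod_cast hmn))

theorem PosOn.eq_zero {γ : ℕ → ℝ} {n : ℕ} (h : PosOn γ n) {f : ℝ[X]} (hf : f.degree < n)
    (hz : ∀ j < n, moment γ (f * X ^ j) = 0) : f = 0 := by
  by_contra h0
  exact (h f hf h0).ne' (moment_mul_eq_zero hz hf)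

/-! ### Gauss quadrature -/

/-- A monic polynomial of degree `r` orthogonal to all polynomials of degree less than `r` has
only real roots: a quadratic factor without real roots would be a sum of two squares. -/
theorem splits_of_orthogonal {γ : ℕ → ℝ} {r : ℕ} {p : ℝ[X]} (hp : p.Monic)
    (hdeg : p.natDegree = r) (hpos : PosOn γ r)
    (horth : ∀ j < r, moment γ (p * X ^ j) = 0) : p.Splits := by
  suffices hirr : ∀ q : ℝ[X], Irreducible q → q ∣ p → q.degree = 1 by
    obtain ⟨u, hu⟩ := UniqueFactorizationMonoid.factors_prod hp.ne_zero
    rw [← hu]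
    refine (Splits.multisetProd fun q hq => ?_).mul u.isUnit.splits
    exact Splits.of_degree_eq_one (hirr q (UniqueFactorizationMonoid.irreducible_of_factor q hq)
      (UniqueFactorizationMonoid.dvd_of_mem_factors hq))
  intro q hq hqp
  obtain ⟨z, hz⟩ := IsAlgClosed.exists_aeval_eq_zero ℂ q hq.degree_pos.ne'
  by_cases him : z.im = 0
  · have hz' : z = algebraMap ℝ ℂ z.re := by
      apply Complex.ext <;> simp [him]
    rw [hz', aeval_algebraMap_apply] at hz
    exact degree_eq_one_of_irreducible_of_root hq (x := z.re) (by simpa [IsRoot.def] using hz)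
  · exfalso
    have hzp : aeval z p = 0 := by
      obtain ⟨c, rfl⟩ := hqp
      simp [hz]
    obtain ⟨g, hg⟩ := p.quadratic_dvd_of_aeval_eq_zero_im_ne_zero hzp him
    have hg0 : g ≠ 0 := by rintro rfl; exact hp.ne_zero (by simpa using hg)
    have hquad : (X ^ 2 - C (2 * z.re) * X + C (‖z‖ ^ 2) : ℝ[X])
        = (X - C z.re) ^ 2 + C (z.im ^ 2) := by
      rw [← Complex.normSq_eq_norm_sq, Complex.normSq_apply]
      simp only [map_mul, map_add, map_pow, map_ofNat]
      ring
    rw [hquad] at hg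
    have hqd : ((X - C z.re) ^ 2 + C (z.im ^ 2) : ℝ[X]).natDegree = 2 := by
      rw [natDegree_add_C, natDegree_pow, natDegree_X_sub_C]
    have hq0 : ((X - C z.re) ^ 2 + C (z.im ^ 2) : ℝ[X]) ≠ 0 := by
      intro h; rw [h] at hqd; simp at hqd
    have hgd : g.natDegree + 2 = r := by
      rw [← hdeg, hg, natDegree_mul hq0 hg0, hqd, add_comm]
    have h1 : moment γ (p * g) = 0 := moment_mul_eq_zero horth
      ((natDegree_lt_iff_degree_lt hg0).1 (by omega))
    have h2 : 0 < moment γ (((X - C z.re) * g) * ((X - C z.re) * g)) := by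
      have hne : (X - C z.re) * g ≠ 0 := mul_ne_zero (X_sub_C_ne_zero _) hg0
      refine hpos _ ((natDegree_lt_iff_degree_lt hne).1 ?_) hne
      rw [natDegree_mul (X_sub_C_ne_zero _) hg0, natDegree_X_sub_C]
      omega
    have h3 : 0 < moment γ (g * g) :=
      hpos _ ((natDegree_lt_iff_degree_lt hg0).1 (by omega)) hg0
    have h4 : p * g = ((X - C z.re) * g) * ((X - C z.re) * g) + C (z.im ^ 2) * (g * g) := by
      conv_lhs => rw [hg]
      ring
    rw [h4, map_add, moment_C_mul] at h1
    have : 0 ≤ z.im ^ 2 * moment γ (g * g) := by positivity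
    linarith

/-- A monic polynomial of degree `r` orthogonal to all polynomials of degree less than `r` has
no multiple roots. -/
theorem roots_nodup_of_orthogonal {γ : ℕ → ℝ} {r : ℕ} {p : ℝ[X]} (hp : p.Monic)
    (hdeg : p.natDegree = r) (hpos : PosOn γ r)
    (horth : ∀ j < r, moment γ (p * X ^ j) = 0) : p.roots.Nodup := by
  rw [Multiset.nodup_iff_count_le_one]
  intro a
  rw [count_roots]
  by_contra! hcon
  obtain ⟨g, hg⟩ := (le_rootMultiplicity_iff hp.ne_zero).1 hcon
  have hg0 : g ≠ 0 := by rintro rfl; exact hp.ne_zero (by simpa using hg)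
  have hgd : g.natDegree + 2 = r := by
    rw [← hdeg, hg, natDegree_mul (pow_ne_zero _ (X_sub_C_ne_zero _)) hg0, natDegree_pow,
      natDegree_X_sub_C]
    omega
  have h1 : moment γ (p * g) = 0 := moment_mul_eq_zero horth
    ((natDegree_lt_iff_degree_lt hg0).1 (by omega))
  have h2 : 0 < moment γ (((X - C a) * g) * ((X - C a) * g)) := by
    have hne : (X - C a) * g ≠ 0 := mul_ne_zero (X_sub_C_ne_zero _) hg0
    refine hpos _ ((natDegree_lt_iff_degree_lt hne).1 ?_) hne
    rw [natDegree_mul (X_sub_C_ne_zero _) hg0, natDegree_X_sub_C]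
    omega
  have h4 : p * g = ((X - C a) * g) * ((X - C a) * g) := by
    conv_lhs => rw [hg]
    ring
  rw [h4] at h1
  exact h2.ne' h1

/-- Gauss quadrature. If the Hankel form of `γ` is positive definite in degrees below `r` and the
moments up to order `N` satisfy the linear recursion given by a monic polynomial `p` of degree `r`,
then they are the moments of a positive combination of `r` point masses, at the roots of `p`. The
weight at a root is the moment of the corresponding Lagrange polynomial `ℓ`, which equals the
moment of `ℓ ^ 2`. -/
theorem exists_quadrature {γ : ℕ → ℝ} {r N : ℕ} {p : ℝ[X]} (hp : p.Monic)
    (hdeg : p.natDegree = r) (hpos : PosOn γ r) (hN : 2 * r ≤ N + 1)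
    (horth : ∀ j, r + j ≤ N → moment γ (p * X ^ j) = 0) :
    ∃ (S : Finset ℝ) (c : ℝ → ℝ), S.card = r ∧ (∀ t ∈ S, 0 < c t) ∧
      ∀ i ≤ N, γ i = ∑ t ∈ S, c t * t ^ i := by
  have horth' : ∀ j < r, moment γ (p * X ^ j) = 0 := fun j hj => horth j (by omega)
  have hsplit := splits_of_orthogonal hp hdeg hpos horth'
  have hnodup := roots_nodup_of_orthogonal hp hdeg hpos horth'
  set S : Finset ℝ := p.roots.toFinset with hS
  have hcard : S.card = r := by
    rw [hS, Multiset.toFinset_card_of_nodup hnodup, ← hdeg]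
    exact splits_iff_card_roots.1 hsplit
  have hroot : ∀ t ∈ S, p.eval t = 0 := fun t ht => by
    rw [hS, Multiset.mem_toFinset] at ht
    exact (mem_roots'.1 ht).2
  have hinj : Set.InjOn (id : ℝ → ℝ) S := Function.injective_id.injOn
  have hpdeg : p.degree = r := by rw [degree_eq_natDegree hp.ne_zero, hdeg]
  -- a polynomial of degree at most `N` vanishing at the roots of `p` has moment zero
  have hvan : ∀ f : ℝ[X], f.natDegree ≤ N → (∀ t ∈ S, f.eval t = 0) → moment γ f = 0 := by
    intro f hfN hf
    have hmod : f %ₘ p = 0 := by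
      refine eq_zero_of_degree_lt_of_eval_finset_eq_zero S ?_ fun t ht => ?_
      · rw [hcard, ← hpdeg]; exact degree_modByMonic_lt f hp
      · have := congrArg (eval t) (modByMonic_add_div f p)
        rw [eval_add, eval_mul, hroot t ht, zero_mul, add_zero, hf t ht] at this
        exact this
    have hf' := modByMonic_add_div f p
    rw [hmod, zero_add] at hf'
    by_cases h0 : f = 0
    · rw [h0, map_zero]
    have hq0 : f /ₘ p ≠ 0 := by
      intro h; rw [h, mul_zero] at hf'; exact h0 hf'.symm
    have hqd := natDegree_mul hp.ne_zero hq0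
    rw [hf', hdeg] at hqd
    rw [← hf']
    refine moment_mul_eq_zero (n := (f /ₘ p).natDegree + 1) (fun j hj => horth j (by omega)) ?_
    exact (natDegree_lt_iff_degree_lt hq0).1 (Nat.lt_succ_self _)
  refine ⟨S, fun t => moment γ (Lagrange.basis S id t), hcard, fun t ht => ?_, fun i hi => ?_⟩
  · have hd : (Lagrange.basis S id t).natDegree = r - 1 := by
      rw [Lagrange.natDegree_basis hinj ht, hcard]
    have hr : 0 < r := hcard ▸ Finset.card_pos.2 ⟨t, ht⟩
    have hne := Lagrange.basis_ne_zero hinj ht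
    have hsq : moment γ (Lagrange.basis S id t * Lagrange.basis S id t - Lagrange.basis S id t)
        = 0 := by
      refine hvan _ ((natDegree_sub_le _ _).trans (max_le (natDegree_mul_le.trans ?_) ?_)) ?_
      · omega
      · omega
      · intro t' ht'
        rw [eval_sub, eval_mul]
        by_cases h : t = t'
        · subst h
          have := Lagrange.eval_basis_self hinj ht
          simp only [id] at this
          simp [this]
        · have := Lagrange.eval_basis_of_ne (v := (id : ℝ → ℝ)) h ht'
          simp only [id] at this
          simp [this]
    rw [map_sub, sub_eq_zero] at hsq
    change 0 < moment γ (Lagrange.basis S id t)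
    rw [← hsq]
    exact hpos _ ((natDegree_lt_iff_degree_lt hne).1 (by omega)) hne
  · have h0 : moment γ (X ^ i - Lagrange.interpolate S id fun t => t ^ i) = 0 := by
      refine hvan _ ((natDegree_sub_le _ _).trans (max_le (by simpa using hi) ?_)) ?_
      · by_cases hz : Lagrange.interpolate S id (fun t => t ^ i) = 0
        · rw [hz]; simp
        have := (natDegree_lt_iff_degree_lt hz).2
          (Lagrange.degree_interpolate_lt (fun t => t ^ i) hinj)
        omega
      · intro t ht
        have := Lagrange.eval_interpolate_at_node (fun t : ℝ => t ^ i) hinj ht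
        simp only [id] at this
        rw [eval_sub, eval_pow, eval_X, this, sub_self]
    rw [map_sub, sub_eq_zero, moment_X_pow] at h0
    rw [h0, Lagrange.interpolate_apply, map_sum]
    exact Finset.sum_congr rfl fun t _ => by rw [moment_C_mul, mul_comm]

/-! ### Monic polynomials -/

theorem degree_sub_lt_of_monic {p q : ℝ[X]} {n : ℕ} (hp : p.Monic) (hq : q.Monic)
    (hpn : p.natDegree = n) (hqn : q.natDegree = n) : (p - q).degree < n := by
  have hd : p.degree = q.degree := by
    rw [degree_eq_natDegree hp.ne_zero, degree_eq_natDegree hq.ne_zero, hpn, hqn]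
  rw [← hpn, ← degree_eq_natDegree hp.ne_zero]
  exact degree_sub_lt_left hd hp.ne_zero (by rw [hp.leadingCoeff, hq.leadingCoeff])

theorem monic_X_pow_sub_of_degree_lt {g : ℝ[X]} {n : ℕ} (hg : g.degree < n) :
    (X ^ n - g).Monic ∧ (X ^ n - g).natDegree = n := by
  rw [← degree_X_pow (R := ℝ) n] at hg
  refine ⟨?_, ?_⟩
  · rw [Monic, leadingCoeff_sub_of_degree_lt hg, leadingCoeff_X_pow]
  · rw [natDegree_eq_of_degree_eq (degree_sub_eq_left_of_degree_lt hg), natDegree_X_pow]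

/-! ### Hankel matrices as Gram matrices of the moment functional -/

/-- The polynomial `∑ aᵢ Xⁱ` with coefficient vector `a`. -/
def vecPoly {n : ℕ} (a : Fin n → ℝ) : ℝ[X] := ∑ i, C (a i) * X ^ (i : ℕ)

theorem degree_vecPoly_lt {n : ℕ} (a : Fin n → ℝ) : (vecPoly a).degree < n :=
  degree_sum_fin_lt a

theorem coeff_vecPoly {n : ℕ} (a : Fin n → ℝ) (i : Fin n) : (vecPoly a).coeff i = a i := by
  simp [vecPoly, coeff_X_pow, Fin.val_inj]

theorem vecPoly_coeff {n : ℕ} {f : ℝ[X]} (hf : f.degree < n) :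
    vecPoly (fun i : Fin n => f.coeff i) = f := by
  by_cases h0 : f = 0
  · simp [vecPoly, h0]
  · conv_rhs => rw [f.as_sum_range_C_mul_X_pow' ((natDegree_lt_iff_degree_lt h0).2 hf)]
    rw [vecPoly, Fin.sum_univ_eq_sum_range (fun i => C (f.coeff i) * X ^ i)]

theorem vecPoly_ne_zero {n : ℕ} {a : Fin n → ℝ} (ha : a ≠ 0) : vecPoly a ≠ 0 := by
  intro h
  refine ha (funext fun i => ?_)
  rw [← coeff_vecPoly a i, h, coeff_zero, Pi.zero_apply]

theorem moment_vecPoly_mul {n : ℕ} (γ : ℕ → ℝ) (a : Fin n → ℝ) (f : ℝ[X]) :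
    moment γ (vecPoly a * f) = ∑ i, a i * moment γ (X ^ (i : ℕ) * f) := by
  simp only [vecPoly, Finset.sum_mul, map_sum, mul_assoc, moment_C_mul]

theorem moment_vecPoly_mul_X_pow {n : ℕ} (γ : ℕ → ℝ) (a : Fin n → ℝ) (j : ℕ) :
    moment γ (vecPoly a * X ^ j) = ∑ i, a i * γ (i + j) := by
  simp only [moment_vecPoly_mul, ← pow_add, moment_X_pow]

theorem hankel_mulVec (γ : ℕ → ℝ) (m : ℕ) (a : Fin (m + 1) → ℝ) (i : Fin (m + 1)) :
    (hankel γ m).mulVec a i = moment γ (vecPoly a * X ^ (i : ℕ)) := by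
  rw [moment_vecPoly_mul_X_pow]
  simp only [hankel, Matrix.mulVec, dotProduct, Matrix.of_apply]
  exact Finset.sum_congr rfl fun j _ => by rw [mul_comm, add_comm]

theorem dotProduct_hankel_mulVec (γ : ℕ → ℝ) (m : ℕ) (a : Fin (m + 1) → ℝ) :
    dotProduct a ((hankel γ m).mulVec a) = moment γ (vecPoly a * vecPoly a) := by
  rw [moment_vecPoly_mul]
  simp only [dotProduct, hankel_mulVec]
  exact Finset.sum_congr rfl fun i _ => by rw [mul_comm (vecPoly a)]

theorem hankel_isHermitian (γ : ℕ → ℝ) (m : ℕ) : (hankel γ m).IsHermitian := by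
  ext i j
  simp [hankel, add_comm]

theorem posDef_hankel_iff {γ : ℕ → ℝ} {m : ℕ} : (hankel γ m).PosDef ↔ PosOn γ (m + 1) := by
  constructor
  · intro h f hf h0
    rw [← vecPoly_coeff hf] at h0 ⊢
    rw [← dotProduct_hankel_mulVec]
    have := h.dotProduct_mulVec_pos (x := fun i : Fin (m + 1) => f.coeff i) (by
      intro hz
      rw [hz] at h0
      exact h0 (by simp [vecPoly]))
    simpa using this
  · intro h
    refine .of_dotProduct_mulVec_pos (hankel_isHermitian γ m) fun a ha => ?_
    have := h (vecPoly a) (degree_vecPoly_lt a) (vecPoly_ne_zero ha)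
    rw [← dotProduct_hankel_mulVec] at this
    simpa using this

/-! ### The rank of a sequence -/

theorem seqRank_eq_succ {γ : ℕ → ℝ} {m : ℕ} (h : PosOn γ (m + 1)) : seqRank γ m = m + 1 := by
  rw [seqRank, if_pos (posDef_hankel_iff.2 h).isUnit]

/-- A column of a Hankel matrix depends on the preceding ones if and only if some monic polynomial
of the corresponding degree has its coefficient vector in the kernel. -/
theorem hankelCol_mem_span_iff {γ : ℕ → ℝ} {m i : ℕ} :
    hankelCol γ m i ∈ Submodule.span ℝ (hankelCol γ m '' {j | j < i}) ↔
      ∃ g : ℝ[X], g.degree < i ∧ ∀ l ≤ m, moment γ ((X ^ i - g) * X ^ l) = 0 := by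
  set Φ : ℝ[X] →ₗ[ℝ] (Fin (m + 1) → ℝ) :=
    LinearMap.pi fun l => moment γ ∘ₗ LinearMap.mulRight ℝ (X ^ (l : ℕ)) with hΦ
  have hcol : ∀ j, Φ (X ^ j) = hankelCol γ m j := fun j => by
    ext l
    simp [hΦ, hankelCol, ← pow_add, moment_X_pow]
  have himg : hankelCol γ m '' {j | j < i} = Φ '' ((fun j => X ^ j) '' {j | j < i}) := by
    rw [Set.image_image]
    simp only [hcol]
  have hspan : Submodule.span ℝ (((fun j => X ^ j) '' {j | j < i} : Set ℝ[X])) =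
      degreeLT ℝ i := by
    rw [degreeLT_eq_span_X_pow]
    congr 1
    ext f
    simp
  rw [himg, ← Submodule.map_span, hspan, ← hcol, Submodule.mem_map]
  refine exists_congr fun g => and_congr mem_degreeLT ?_
  rw [eq_comm, ← sub_eq_zero, ← map_sub, funext_iff]
  constructor
  · intro h l hl
    simpa [hΦ] using h ⟨l, Nat.lt_succ_of_le hl⟩
  · intro h l
    simpa [hΦ] using h l (Nat.lt_succ_iff.1 l.2)

/-- The rank of a singular sequence is the degree of its minimal recursion. -/
theorem seqRank_eq_natDegree {γ : ℕ → ℝ} {m r : ℕ} {p : ℝ[X]} (hp : p.Monic)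
    (hdeg : p.natDegree = r) (hr : r ≤ m) (hpos : PosOn γ r)
    (horth : ∀ j ≤ m, moment γ (p * X ^ j) = 0) : seqRank γ m = r := by
  have hsing : ¬ IsUnit (hankel γ m) := by
    intro hu
    have hpd : p.degree < (m + 1 : ℕ) :=
      (natDegree_lt_iff_degree_lt hp.ne_zero).1 (by omega)
    have h0 : (hankel γ m).mulVec (fun i => p.coeff i) = (hankel γ m).mulVec 0 := by
      ext i
      rw [hankel_mulVec, vecPoly_coeff hpd, horth i (Nat.lt_succ_iff.1 i.2), Matrix.mulVec_zero,
        Pi.zero_apply]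
    have := Matrix.mulVec_injective_of_isUnit hu h0
    refine hp.ne_zero ?_
    rw [← vecPoly_coeff hpd, this]
    simp [vecPoly]
  rw [seqRank, if_neg hsing]
  have hmem : hankelCol γ m r ∈ Submodule.span ℝ (hankelCol γ m '' {j | j < r}) :=
    hankelCol_mem_span_iff.2 ⟨X ^ r - p, degree_sub_lt_of_monic (monic_X_pow r) hp
      (natDegree_X_pow r) hdeg, fun l hl => by rw [sub_sub_cancel]; exact horth l hl⟩
  refine le_antisymm (Nat.sInf_le ⟨hr, hmem⟩) (le_csInf ⟨r, hr, hmem⟩ ?_)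
  rintro b ⟨-, hb⟩
  by_contra! hbr
  obtain ⟨g, hg, hg'⟩ := hankelCol_mem_span_iff.1 hb
  obtain ⟨hmon, hnd⟩ := monic_X_pow_sub_of_degree_lt hg
  refine hmon.ne_zero (hpos.eq_zero ?_ fun j hj => hg' j (by omega))
  exact (natDegree_lt_iff_degree_lt hmon.ne_zero).1 (by omega)

/-! ### Representing measures and finite sums -/

theorem Represents.integrable_eval {μ : Measure ℝ} {k : ℕ} {γ : ℕ → ℝ} (h : Represents μ k γ)
    {f : ℝ[X]} (hf : f.natDegree ≤ 2 * k) : Integrable (fun t => f.eval t) μ := by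
  simp only [eval_eq_sum_range]
  exact integrable_finsetSum _ fun i hi =>
    ((h i (by have := Finset.mem_range.1 hi; omega)).1).const_mul _

theorem Represents.integral_eval {μ : Measure ℝ} {k : ℕ} {γ : ℕ → ℝ} (h : Represents μ k γ)
    {f : ℝ[X]} (hf : f.natDegree ≤ 2 * k) : ∫ t, f.eval t ∂μ = moment γ f := by
  simp only [eval_eq_sum_range]
  rw [integral_finsetSum, moment_eq_sum γ (Nat.lt_succ_self _)]
  · refine Finset.sum_congr rfl fun i hi => ?_
    rw [integral_const_mul, (h i (by have := Finset.mem_range.1 hi; omega)).2]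
  · exact fun i hi => ((h i (by have := Finset.mem_range.1 hi; omega)).1).const_mul _

theorem Represents.moment_sq_nonneg {μ : Measure ℝ} {k : ℕ} {γ : ℕ → ℝ} (h : Represents μ k γ)
    {f : ℝ[X]} (hf : f.natDegree ≤ k) : 0 ≤ moment γ (f * f) := by
  rw [← h.integral_eval (natDegree_mul_le.trans (by omega))]
  exact integral_nonneg fun t => by simpa using mul_self_nonneg (f.eval t)

/-- The moments `γ i` with `i ≤ N` are those of the point masses `c t` at the points `t` of `S`,
where all `c t` are positive. -/
def IsQuadrature (γ : ℕ → ℝ) (N : ℕ) (S : Finset ℝ) (c : ℝ → ℝ) : Prop :=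
  (∀ t ∈ S, 0 < c t) ∧ ∀ i ≤ N, γ i = ∑ t ∈ S, c t * t ^ i

theorem IsQuadrature.moment_eq {γ : ℕ → ℝ} {N : ℕ} {S : Finset ℝ} {c : ℝ → ℝ}
    (h : IsQuadrature γ N S c) {f : ℝ[X]} (hf : f.natDegree ≤ N) :
    moment γ f = ∑ t ∈ S, c t * f.eval t := by
  rw [moment_eq_sum γ (Nat.lt_succ_self _)]
  simp only [eval_eq_sum_range, Finset.mul_sum]
  rw [Finset.sum_comm]
  refine Finset.sum_congr rfl fun i hi => ?_
  rw [h.2 i (by have := Finset.mem_range.1 hi; omega), Finset.mul_sum]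
  exact Finset.sum_congr rfl fun t _ => by ring

theorem represents_sum_dirac_iff {γ : ℕ → ℝ} {k : ℕ} {S : Finset ℝ} {c : ℝ → ℝ}
    (hc : ∀ t ∈ S, 0 < c t) :
    Represents (∑ t ∈ S, ENNReal.ofReal (c t) • Measure.dirac t) k γ ↔
      ∀ i ≤ 2 * k, γ i = ∑ t ∈ S, c t * t ^ i := by
  have hint : ∀ i : ℕ, ∀ t ∈ S,
      Integrable (fun x : ℝ => x ^ i) (ENNReal.ofReal (c t) • Measure.dirac t) := fun i t _ =>
    (integrable_dirac (by simp)).smul_measure ENNReal.ofReal_ne_top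
  refine forall₂_congr fun i _ => ?_
  rw [integral_finsetSum_measure (hint i), eq_comm,
    and_iff_right (integrable_finsetSum_measure.2 (hint i))]
  refine Eq.congr rfl (Finset.sum_congr rfl fun t ht => ?_)
  rw [integral_smul_measure, integral_dirac, ENNReal.toReal_ofReal (hc t ht).le, smul_eq_mul]

theorem hasAtomicMeasure_iff {r k : ℕ} {β : ℕ → ℝ} : HasAtomicMeasure r k β ↔
    ∃ (x y : ℝ) (S : Finset ℝ) (c : ℝ → ℝ), S.card = r ∧
      IsQuadrature (fillGaps k β x y) (2 * k) S c := by
  constructor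
  · rintro ⟨x, y, _, ⟨S, c, hS, hc, rfl⟩, h⟩
    exact ⟨x, y, S, c, hS, hc, (represents_sum_dirac_iff hc).1 h⟩
  · rintro ⟨x, y, S, c, hS, hc, h⟩
    exact ⟨x, y, _, ⟨S, c, hS, hc, rfl⟩, (represents_sum_dirac_iff hc).2 h⟩

theorem HasAtomicMeasure.hasMeasure {r k : ℕ} {β : ℕ → ℝ} (h : HasAtomicMeasure r k β) :
    HasMeasure k β := by
  obtain ⟨x, y, μ, _, hμ⟩ := h
  exact ⟨x, y, μ, hμ⟩

/-- If the Hankel form of a measure is degenerate in degree `n`, the measure lives on the zeros of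
a polynomial of degree at most `n`. -/
theorem Represents.exists_quadrature_of_not_posOn {μ : Measure ℝ} {k n : ℕ} {γ : ℕ → ℝ}
    (h : Represents μ k γ) (hn : n ≤ k) (hpos : ¬ PosOn γ (n + 1)) :
    ∃ (S : Finset ℝ) (c : ℝ → ℝ), S.card ≤ n ∧ IsQuadrature γ (2 * k) S c := by
  rw [PosOn] at hpos
  push Not at hpos
  obtain ⟨f, hfd, hf0, hf⟩ := hpos
  have hfn : f.natDegree < n + 1 := (natDegree_lt_iff_degree_lt hf0).2 hfd
  have hff : (f * f).natDegree ≤ 2 * k := natDegree_mul_le.trans (by omega)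
  have hae : ∀ᵐ t ∂μ, t ∈ f.roots.toFinset := by
    have hint := h.integrable_eval hff
    have hnn : 0 ≤ᵐ[μ] fun t => (f * f).eval t :=
      .of_forall fun t => by simpa using mul_self_nonneg (f.eval t)
    have hz : ∫ t, (f * f).eval t ∂μ = 0 :=
      le_antisymm ((h.integral_eval hff).trans_le hf) (integral_nonneg_of_ae hnn)
    filter_upwards [(integral_eq_zero_iff_of_nonneg_ae hnn hint).1 hz] with t ht
    simpa [hf0] using ht
  set T := f.roots.toFinset with hT
  have hTn : T.card ≤ n := (Multiset.toFinset_card_le _).trans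
    ((card_roots' f).trans (by omega))
  refine ⟨T.filter fun t => 0 < μ.real {t}, fun t => μ.real {t},
    (Finset.card_filter_le _ _).trans hTn, fun t ht => (Finset.mem_filter.1 ht).2,
    fun i hi => ?_⟩
  have hi' := h i hi
  have hres : μ.restrict T = μ := Measure.restrict_eq_self_of_ae_mem hae
  rw [← hi'.2]
  conv_lhs => rw [← hres]
  rw [setIntegral_finset T hi'.1.integrableOn, Finset.sum_filter]
  refine Finset.sum_congr rfl fun t _ => ?_
  split_ifs with h0
  · rfl
  · rw [le_antisymm (not_lt.1 h0) measureReal_nonneg, zero_smul]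

/-! ### Division by an orthogonal polynomial -/

/-- If `p` is monic of degree `r` and orthogonal to degrees below `r + d`, then any monic `q` of
degree `r + d` orthogonal to degrees below `r` is a multiple of `p`: the remainder is orthogonal to
its own degree range. -/
theorem exists_eq_mul_of_orthogonal {γ : ℕ → ℝ} {r d : ℕ} {p q : ℝ[X]} (hp : p.Monic)
    (hpr : p.natDegree = r) (hq : q.Monic) (hqd : q.natDegree = r + d) (hpos : PosOn γ r)
    (horthp : ∀ j < r + d, moment γ (p * X ^ j) = 0)
    (horthq : ∀ j < r, moment γ (q * X ^ j) = 0) :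
    ∃ h : ℝ[X], h.Monic ∧ h.natDegree = d ∧ q = p * h := by
  have hdiv := modByMonic_add_div q p
  have hle : p.degree ≤ q.degree := by
    rw [degree_eq_natDegree hp.ne_zero, degree_eq_natDegree hq.ne_zero, hpr, hqd]
    exact_mod_cast Nat.le_add_right r d
  have hmon : (q /ₘ p).Monic := by
    rw [Monic, leadingCoeff_divByMonic_of_monic hp hle, hq]
  have hnd : (q /ₘ p).natDegree = d := by
    rw [natDegree_divByMonic q hp, hqd, hpr, Nat.add_sub_cancel_left]
  have hrem : q %ₘ p = 0 := by
    refine hpos.eq_zero ?_ fun j hj => ?_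
    · rw [← hpr, ← degree_eq_natDegree hp.ne_zero]
      exact degree_modByMonic_lt q hp
    · rw [eq_sub_of_add_eq hdiv, sub_mul, map_sub, horthq j hj, mul_assoc, zero_sub, neg_eq_zero]
      refine moment_mul_eq_zero horthp ?_
      have hne : (q /ₘ p) * X ^ j ≠ 0 := (hmon.mul (monic_X_pow j)).ne_zero
      refine (natDegree_lt_iff_degree_lt hne).1 ?_
      rw [hmon.natDegree_mul (monic_X_pow j), hnd, natDegree_X_pow]
      omega
  refine ⟨_, hmon, hnd, ?_⟩
  rw [hrem, zero_add] at hdiv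
  exact hdiv.symm

/-- One more step of a recursion `p`, read off from a single vanishing moment of a multiple. -/
theorem moment_mul_X_pow_eq_zero_of_mul {γ : ℕ → ℝ} {d i : ℕ} {p h : ℝ[X]} (hh : h.Monic)
    (hd : h.natDegree = d) (horth : ∀ j < d + i, moment γ (p * X ^ j) = 0)
    (hz : moment γ (p * h * X ^ i) = 0) : moment γ (p * X ^ (d + i)) = 0 := by
  have hlt : (X ^ (d + i) - h * X ^ i : ℝ[X]).degree < (d + i : ℕ) :=
    degree_sub_lt_of_monic (monic_X_pow _) (hh.mul (monic_X_pow i)) (natDegree_X_pow _)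
      (by rw [hh.natDegree_mul (monic_X_pow i), hd, natDegree_X_pow])
  have := moment_mul_eq_zero horth hlt
  rw [mul_sub, map_sub, ← mul_assoc, hz, sub_zero] at this
  exact this

/-! ### Filling the gaps -/

theorem fillGaps_eq {k : ℕ} {β : ℕ → ℝ} {x y : ℝ} {i : ℕ} (h1 : i ≠ 2 * k - 2)
    (h2 : i ≠ 2 * k - 1) : fillGaps k β x y i = β i := by
  rw [fillGaps, if_neg h1, if_neg h2]

theorem moment_fillGaps {k : ℕ} (hk : 2 ≤ k) (β : ℕ → ℝ) (x y : ℝ) (f : ℝ[X]) :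
    moment (fillGaps k β x y) f = moment (fillGaps k β 0 0) f + y * f.coeff (2 * k - 2) +
      x * f.coeff (2 * k - 1) := by
  have := linear_eq_of_X_pow (φ := moment (fillGaps k β x y))
    (ψ := moment (fillGaps k β 0 0) + y • lcoeff ℝ (2 * k - 2) + x • lcoeff ℝ (2 * k - 1))
    (n := f.natDegree + 1) (fun j _ => ?_) (f := f)
    (degree_le_natDegree.trans_lt (by exact_mod_cast Nat.lt_succ_self _))
  · simpa using this
  · simp only [LinearMap.add_apply, LinearMap.smul_apply, lcoeff_apply, moment_X_pow, coeff_X_pow,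
      smul_eq_mul, fillGaps]
    by_cases h1 : j = 2 * k - 2
    · have h2 : 2 * k - 2 ≠ 2 * k - 1 := by omega
      simp [h1, h2.symm]
    · by_cases h2 : j = 2 * k - 1
      · have h3 : 2 * k - 1 ≠ 2 * k - 2 := by omega
        simp [h2, h3, h3.symm]
      · simp [h1, h2, Ne.symm h1, Ne.symm h2]

theorem moment_fillGaps_of_natDegree_lt {k : ℕ} (β : ℕ → ℝ) (x y : ℝ) {f : ℝ[X]}
    (hf : f.natDegree < 2 * k - 2) : moment (fillGaps k β x y) f = moment β f :=
  moment_congr fun i hi => fillGaps_eq (by omega) (by omega)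

theorem exists_moment_fillGaps_eq_zero {k : ℕ} (hk : 2 ≤ k) (β : ℕ → ℝ) (y : ℝ) {f : ℝ[X]}
    (hf : f.Monic) (hd : f.natDegree = 2 * k - 1) :
    ∃ x, moment (fillGaps k β x y) f = 0 := by
  have hc : f.coeff (2 * k - 1) = 1 := hd ▸ hf.coeff_natDegree
  refine ⟨-(moment (fillGaps k β 0 0) f + y * f.coeff (2 * k - 2)), ?_⟩
  rw [moment_fillGaps hk, hc]
  ring

theorem exists_forall_moment_fillGaps_eq_zero {k : ℕ} (hk : 2 ≤ k) (β : ℕ → ℝ) {f : ℝ[X]}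
    (hf : f.Monic) (hd : f.natDegree = 2 * k - 2) :
    ∃ y, ∀ x, moment (fillGaps k β x y) f = 0 := by
  have hc : f.coeff (2 * k - 2) = 1 := hd ▸ hf.coeff_natDegree
  have hc' : f.coeff (2 * k - 1) = 0 := coeff_eq_zero_of_natDegree_lt (by omega)
  refine ⟨-moment (fillGaps k β 0 0) f, fun x => ?_⟩
  rw [moment_fillGaps hk, hc, hc']
  ring

theorem posOn_fillGaps_iff {k n : ℕ} {β : ℕ → ℝ} {x y : ℝ} (hn : n < k) :
    PosOn (fillGaps k β x y) n ↔ PosOn β n := by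
  refine forall₂_congr fun f hf => forall_congr' fun h0 => ?_
  have := (natDegree_lt_iff_degree_lt h0).2 hf
  rw [moment_fillGaps_of_natDegree_lt]
  exact natDegree_mul_le.trans_lt (by omega)

/-! ### Orthogonal polynomials of a sequence with gaps -/

/-- Three polynomials carry all the information about the sequence with gaps. Each is orthogonal,
for every completion, to a range of low degrees: `p₀ = X ^ (k-1) - ⋯` to degrees below `k - 1`,
`p₁ = X ^ (k-2) - ⋯` to degrees below `k - 2`, and `p₂ = X ^ k - ⋯`, which has no terms of degree
`k - 1` and `k - 2`, to degrees below `k - 2`. The numbers `S`, `m`, `σ`, `τ` describe the Gram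
matrices: `⟨p₀, p₀⟩ = y - S` while `p₁`, `p₂` have Gram matrix `(σ, y - m; y - m, τ)`. -/
structure GapData (k : ℕ) (β : ℕ → ℝ) (S m σ τ : ℝ) (p₀ p₁ p₂ : ℝ[X]) : Prop where
  monic₀ : p₀.Monic
  natDegree₀ : p₀.natDegree = k - 1
  monic₁ : p₁.Monic
  natDegree₁ : p₁.natDegree = k - 2
  degree₂ : (X ^ k - p₂ : ℝ[X]).degree < (k - 2 : ℕ)
  orth₀ : ∀ x y, ∀ j < k - 1, moment (fillGaps k β x y) (p₀ * X ^ j) = 0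
  val₀ : ∀ x y, moment (fillGaps k β x y) (p₀ * X ^ (k - 1)) = y - S
  orth₁ : ∀ x y, ∀ j < k - 2, moment (fillGaps k β x y) (p₁ * X ^ j) = 0
  val₁ : ∀ x y, moment (fillGaps k β x y) (p₁ * X ^ (k - 2)) = σ
  cross₁ : ∀ x y, moment (fillGaps k β x y) (p₁ * X ^ k) = y - m
  orth₂ : ∀ x y, ∀ j < k - 2, moment (fillGaps k β x y) (p₂ * X ^ j) = 0
  val₂ : ∀ x y, moment (fillGaps k β x y) (p₂ * X ^ k) = τ

/-- The polynomial `p₂ - ((y - m) / σ) p₁`, orthogonal to all degrees below `k - 1`. -/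
def gapPoly (m σ y : ℝ) (p₁ p₂ : ℝ[X]) : ℝ[X] := p₂ - C ((y - m) / σ) * p₁

namespace GapData

variable {k : ℕ} {β : ℕ → ℝ} {S m σ τ : ℝ} {p₀ p₁ p₂ : ℝ[X]}

theorem moment_mul_eq {x y : ℝ} {p f : ℝ[X]} {n i : ℕ}
    (horth : ∀ j < n, moment (fillGaps k β x y) (p * X ^ j) = 0)
    (hf : (X ^ i - f : ℝ[X]).degree < n) :
    moment (fillGaps k β x y) (p * f) = moment (fillGaps k β x y) (p * X ^ i) := by
  have := moment_mul_eq_zero horth hf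
  rw [mul_sub, map_sub, sub_eq_zero] at this
  exact this.symm

theorem moment_p₀_sq (D : GapData k β S m σ τ p₀ p₁ p₂) (x y : ℝ) :
    moment (fillGaps k β x y) (p₀ * p₀) = y - S := by
  rw [moment_mul_eq (D.orth₀ x y) (i := k - 1), D.val₀]
  exact degree_sub_lt_of_monic (monic_X_pow _) D.monic₀ (natDegree_X_pow _) D.natDegree₀

theorem degree_X_pow_sub_p₁ (D : GapData k β S m σ τ p₀ p₁ p₂) :
    (X ^ (k - 2) - p₁ : ℝ[X]).degree < (k - 2 : ℕ) :=
  degree_sub_lt_of_monic (monic_X_pow _) D.monic₁ (natDegree_X_pow _) D.natDegree₁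

theorem moment_p₁_sq (D : GapData k β S m σ τ p₀ p₁ p₂) (x y : ℝ) :
    moment (fillGaps k β x y) (p₁ * p₁) = σ := by
  rw [moment_mul_eq (D.orth₁ x y) D.degree_X_pow_sub_p₁, D.val₁]

theorem moment_p₂_sq (D : GapData k β S m σ τ p₀ p₁ p₂) (x y : ℝ) :
    moment (fillGaps k β x y) (p₂ * p₂) = τ := by
  rw [moment_mul_eq (D.orth₂ x y) D.degree₂, D.val₂]

theorem cross₂ (D : GapData k β S m σ τ p₀ p₁ p₂) (x y : ℝ) :
    moment (fillGaps k β x y) (p₂ * X ^ (k - 2)) = y - m := by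
  rw [← moment_mul_eq (D.orth₂ x y) D.degree_X_pow_sub_p₁, mul_comm,
    moment_mul_eq (D.orth₁ x y) D.degree₂, D.cross₁]

theorem pos_σ (D : GapData k β S m σ τ p₀ p₁ p₂) (hk : 2 ≤ k) (hpos : PosOn β (k - 1)) :
    0 < σ := by
  rw [← D.moment_p₁_sq 0 0]
  refine (posOn_fillGaps_iff (by omega)).2 hpos _ ?_ D.monic₁.ne_zero
  refine (natDegree_lt_iff_degree_lt D.monic₁.ne_zero).1 ?_
  rw [D.natDegree₁]
  omega

theorem degree_X_pow_sub_gapPoly_lt (D : GapData k β S m σ τ p₀ p₁ p₂) (hk : 2 ≤ k) (y : ℝ) :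
    (X ^ k - gapPoly m σ y p₁ p₂ : ℝ[X]).degree < (k - 1 : ℕ) := by
  have h : X ^ k - gapPoly m σ y p₁ p₂ = (X ^ k - p₂) + ((y - m) / σ) • p₁ := by
    rw [gapPoly, smul_eq_C_mul]; ring
  rw [h]
  refine (degree_add_le _ _).trans_lt (max_lt ?_ ?_)
  · exact D.degree₂.trans (by exact_mod_cast (by omega : k - 2 < k - 1))
  · refine (degree_smul_le _ _).trans_lt ?_
    refine (natDegree_lt_iff_degree_lt D.monic₁.ne_zero).1 ?_
    rw [D.natDegree₁]
    omega

theorem gapPoly_monic (D : GapData k β S m σ τ p₀ p₁ p₂) (hk : 2 ≤ k) (y : ℝ) :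
    (gapPoly m σ y p₁ p₂).Monic ∧ (gapPoly m σ y p₁ p₂).natDegree = k := by
  have h : gapPoly m σ y p₁ p₂ = X ^ k - (X ^ k - gapPoly m σ y p₁ p₂) := by ring
  rw [h]
  exact monic_X_pow_sub_of_degree_lt ((D.degree_X_pow_sub_gapPoly_lt hk y).trans_le
    (by exact_mod_cast Nat.sub_le k 1))

theorem gapPoly_orth (D : GapData k β S m σ τ p₀ p₁ p₂) (hσ : σ ≠ 0) (x y : ℝ) :
    ∀ j < k - 1, moment (fillGaps k β x y) (gapPoly m σ y p₁ p₂ * X ^ j) = 0 := by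
  intro j hj
  rw [gapPoly, sub_mul, map_sub, mul_assoc, moment_C_mul]
  rcases (by omega : j < k - 2 ∨ j = k - 2) with h | rfl
  · rw [D.orth₁ x y j h, D.orth₂ x y j h]; ring
  · rw [D.val₁, D.cross₂]; field_simp; ring

theorem gapPoly_val (D : GapData k β S m σ τ p₀ p₁ p₂) (x y : ℝ) :
    moment (fillGaps k β x y) (gapPoly m σ y p₁ p₂ * X ^ k) = τ - (y - m) ^ 2 / σ := by
  rw [gapPoly, sub_mul, map_sub, mul_assoc, moment_C_mul, D.val₂, D.cross₁]
  ring

theorem gapPoly_val_eq_zero_iff (D : GapData k β S m σ τ p₀ p₁ p₂) (hσ : σ ≠ 0) (x y : ℝ) :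
    moment (fillGaps k β x y) (gapPoly m σ y p₁ p₂ * X ^ k) = 0 ↔ (y - m) ^ 2 = σ * τ := by
  rw [D.gapPoly_val, sub_eq_zero, eq_div_iff hσ, eq_comm, mul_comm]

/-- Positivity of `⟨p₀, p₀⟩` bounds `y` from below, positivity of the Gram matrix of `p₁`, `p₂`
bounds it from above. -/
theorem le_of_represents (D : GapData k β S m σ τ p₀ p₁ p₂) (hk : 2 ≤ k)
    (hpos : PosOn β (k - 1)) {x y : ℝ} {μ : Measure ℝ}
    (hμ : Represents μ k (fillGaps k β x y)) : S ≤ y ∧ (y - m) ^ 2 ≤ σ * τ := by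
  constructor
  · have := hμ.moment_sq_nonneg (f := p₀) (by rw [D.natDegree₀]; omega)
    rw [D.moment_p₀_sq] at this
    linarith
  · have hσ := D.pos_σ hk hpos
    obtain ⟨hq, hqd⟩ := D.gapPoly_monic hk y
    have h := hμ.moment_sq_nonneg hqd.le
    rw [moment_mul_eq (D.gapPoly_orth hσ.ne' x y) (D.degree_X_pow_sub_gapPoly_lt hk y),
      D.gapPoly_val, sub_nonneg, div_le_iff₀ hσ] at h
    linarith

theorem le_add_sqrt (D : GapData k β S m σ τ p₀ p₁ p₂) (hk : 2 ≤ k)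
    (hpos : PosOn β (k - 1)) (h : HasMeasure k β) : S ≤ m + √(σ * τ) := by
  obtain ⟨x, y, μ, hμ⟩ := h
  obtain ⟨h1, h2⟩ := D.le_of_represents hk hpos hμ
  have := (abs_le.1 (Real.abs_le_sqrt h2)).2
  linarith

/-- If both Gram matrices degenerate at the same `y`, then `p₀` is a recursion for a suitable
completion. -/
theorem hasAtomicMeasure_of_sq_eq (D : GapData k β S m σ τ p₀ p₁ p₂) (hk : 2 ≤ k)
    (hpos : PosOn β (k - 1)) (hS : (S - m) ^ 2 = σ * τ) : HasAtomicMeasure (k - 1) k β := by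
  have hσ := D.pos_σ hk hpos
  obtain ⟨x, hx⟩ := exists_moment_fillGaps_eq_zero hk β S (D.monic₀.mul (monic_X_pow k))
    (by rw [D.monic₀.natDegree_mul (monic_X_pow k), D.natDegree₀, natDegree_X_pow]; omega)
  have hpos' : PosOn (fillGaps k β x S) (k - 1) := (posOn_fillGaps_iff (by omega)).2 hpos
  have horth : ∀ j < k + 1, moment (fillGaps k β x S) (p₀ * X ^ j) = 0 := by
    intro j hj
    rcases (by omega : j < k - 1 ∨ j = k - 1 ∨ j = k) with h | rfl | rfl
    · exact D.orth₀ x S j h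
    · rw [D.val₀, sub_self]
    · exact hx
  obtain ⟨hq, hqd⟩ := D.gapPoly_monic hk S
  obtain ⟨h, hh, hhd, hqh⟩ := exists_eq_mul_of_orthogonal D.monic₀ D.natDegree₀ hq
    (d := 1) (by omega) hpos' (fun j hj => horth j (by omega)) (D.gapPoly_orth hσ.ne' x S)
  have hlast : moment (fillGaps k β x S) (p₀ * X ^ (1 + k)) = 0 := by
    refine moment_mul_X_pow_eq_zero_of_mul hh hhd (fun j hj => horth j (by omega)) ?_
    rw [← hqh, D.gapPoly_val_eq_zero_iff hσ.ne', hS]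
  obtain ⟨T, c, hT, hc, hm⟩ := exists_quadrature (N := 2 * k) D.monic₀ D.natDegree₀ hpos'
    (by omega) (fun j hj => by
      rcases (by omega : j < k + 1 ∨ j = 1 + k) with h | rfl
      · exact horth j h
      · exact hlast)
  exact hasAtomicMeasure_iff.2 ⟨x, S, T, c, hT, hc, hm⟩

/-- If `y > S` makes the Gram matrix of `p₁`, `p₂` degenerate, then the Hankel form is positive
definite in degrees below `k` and `gapPoly` is a recursion for a suitable completion. -/
theorem hasAtomicMeasure_of_lt (D : GapData k β S m σ τ p₀ p₁ p₂) (hk : 2 ≤ k)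
    (hpos : PosOn β (k - 1)) {y : ℝ} (hSy : S < y) (hy : (y - m) ^ 2 = σ * τ) :
    HasAtomicMeasure k k β := by
  have hσ := D.pos_σ hk hpos
  obtain ⟨hq, hqd⟩ := D.gapPoly_monic hk y
  obtain ⟨x, hx⟩ := exists_moment_fillGaps_eq_zero hk β y (hq.mul (monic_X_pow (k - 1)))
    (by rw [hq.natDegree_mul (monic_X_pow _), hqd, natDegree_X_pow]; omega)
  have hpos' : PosOn (fillGaps k β x y) k := by
    intro f hf hf0
    have hpos₁ : PosOn (fillGaps k β x y) (k - 1) := (posOn_fillGaps_iff (by omega)).2 hpos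
    -- split off the component of `f` along `p₀`
    set a := f.coeff (k - 1)
    set g := f - C a * p₀ with hg
    have hgd : g.degree < (k - 1 : ℕ) := by
      rw [degree_lt_iff_coeff_zero]
      intro i hi
      rcases hi.eq_or_lt with rfl | hi
      · have : p₀.coeff (k - 1) = 1 := D.natDegree₀ ▸ D.monic₀.coeff_natDegree
        rw [hg, coeff_sub, coeff_C_mul, this, mul_one, sub_self]
      · have h1 : f.coeff i = 0 :=
          (degree_lt_iff_coeff_zero f k).1 hf i (by omega)
        have h2 : p₀.coeff i = 0 :=
          coeff_eq_zero_of_natDegree_lt (by rw [D.natDegree₀]; exact hi)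
        rw [hg, coeff_sub, coeff_C_mul, h1, h2, mul_zero, sub_zero]
    have hcross : moment (fillGaps k β x y) (p₀ * g) = 0 := moment_mul_eq_zero (D.orth₀ x y) hgd
    have hff : f * f = C (a ^ 2) * (p₀ * p₀) + C (2 * a) * (p₀ * g) + g * g := by
      rw [hg, C_mul, C_pow, map_ofNat]; ring
    rw [hff, map_add, map_add, moment_C_mul, moment_C_mul, hcross, D.moment_p₀_sq, mul_zero,
      add_zero]
    by_cases hg0 : g = 0
    · have ha : a ≠ 0 := by
        rintro ha
        rw [ha, C_0, zero_mul, sub_zero] at hg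
        exact hf0 (hg ▸ hg0)
      rw [hg0, mul_zero, map_zero, add_zero]
      exact mul_pos (by positivity) (sub_pos.2 hSy)
    · exact add_pos_of_nonneg_of_pos (mul_nonneg (sq_nonneg a) (sub_pos.2 hSy).le)
        (hpos₁ g hgd hg0)
  obtain ⟨T, c, hT, hc, hm⟩ := exists_quadrature (N := 2 * k) hq hqd hpos'
    (by omega) (fun j hj => by
      rcases (by omega : j < k - 1 ∨ j = k - 1 ∨ j = k) with h | rfl | rfl
      · exact D.gapPoly_orth hσ.ne' x y j h
      · exact hx
      · rw [D.gapPoly_val_eq_zero_iff hσ.ne', hy])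
  exact hasAtomicMeasure_iff.2 ⟨x, y, T, c, hT, hc, hm⟩

/-- The support of a `(k - 1)`-atomic measure is the zero set of `p₀`, which then divides
`gapPoly`; so both Gram matrices degenerate. -/
theorem sq_eq_of_hasAtomicMeasure (D : GapData k β S m σ τ p₀ p₁ p₂) (hk : 2 ≤ k)
    (hpos : PosOn β (k - 1)) (h : HasAtomicMeasure (k - 1) k β) : (S - m) ^ 2 = σ * τ := by
  obtain ⟨x, y, T, c, hT, hquad⟩ := hasAtomicMeasure_iff.1 h
  have hσ := D.pos_σ hk hpos
  have hpos' : PosOn (fillGaps k β x y) (k - 1) := (posOn_fillGaps_iff (by omega)).2 hpos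
  set P := Lagrange.nodal T (id : ℝ → ℝ) with hP
  have hPm : P.Monic := Lagrange.nodal_monic
  have hPd : P.natDegree = k - 1 := by rw [hP, Lagrange.natDegree_nodal, hT]
  have hvan : ∀ f : ℝ[X], f.natDegree ≤ k + 1 → moment (fillGaps k β x y) (P * f) = 0 := by
    intro f hf
    rw [hquad.moment_eq (natDegree_mul_le.trans (by omega))]
    refine Finset.sum_eq_zero fun t ht => ?_
    have : P.eval t = 0 := Lagrange.eval_nodal_at_node (v := (id : ℝ → ℝ)) ht
    rw [eval_mul, this, zero_mul, mul_zero]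
  have hP₀ : P = p₀ := by
    refine sub_eq_zero.1 (hpos'.eq_zero (degree_sub_lt_of_monic hPm D.monic₀ hPd D.natDegree₀)
      fun j hj => ?_)
    rw [sub_mul, map_sub, D.orth₀ x y j hj, sub_zero]
    exact hvan _ (by rw [natDegree_X_pow]; omega)
  have hy : y = S := by
    have := D.val₀ x y
    rw [← hP₀, hvan _ (by rw [natDegree_X_pow]; omega)] at this
    linarith
  subst hy
  obtain ⟨hq, hqd⟩ := D.gapPoly_monic hk y
  obtain ⟨h, hh, hhd, hqh⟩ := exists_eq_mul_of_orthogonal hPm hPd hq (d := 1) (by omega) hpos'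
    (fun j hj => hvan _ (by rw [natDegree_X_pow]; omega)) (D.gapPoly_orth hσ.ne' x y)
  rw [← D.gapPoly_val_eq_zero_iff hσ.ne' x y, hqh, mul_assoc]
  exact hvan _ (natDegree_mul_le.trans (by rw [natDegree_X_pow]; omega))

theorem sq_eq_iff {S m a : ℝ} (ha : 0 ≤ a) :
    (S - m) ^ 2 = a ↔ S = m - √a ∨ S = m + √a := by
  conv_lhs => rw [← Real.sq_sqrt ha]
  rw [sq_eq_sq_iff_eq_or_eq_neg, or_comm]
  exact or_congr ⟨fun h => by linarith, fun h => by linarith⟩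
    ⟨fun h => by linarith, fun h => by linarith⟩

theorem hasAtomicMeasure_iff_eq (D : GapData k β S m σ τ p₀ p₁ p₂) (hk : 2 ≤ k)
    (hpos : PosOn β (k - 1)) (hτ : 0 ≤ τ) : HasAtomicMeasure (k - 1) k β ↔
      S = m - √(σ * τ) ∨ S = m + √(σ * τ) := by
  rw [← sq_eq_iff (mul_nonneg (D.pos_σ hk hpos).le hτ)]
  exact ⟨D.sq_eq_of_hasAtomicMeasure hk hpos, D.hasAtomicMeasure_of_sq_eq hk hpos⟩

theorem hasAtomicMeasure_of_lt_add_sqrt (D : GapData k β S m σ τ p₀ p₁ p₂) (hk : 2 ≤ k)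
    (hpos : PosOn β (k - 1)) (hτ : 0 ≤ τ) (h : S < m + √(σ * τ)) : HasAtomicMeasure k k β := by
  refine D.hasAtomicMeasure_of_lt hk hpos h ?_
  rw [add_sub_cancel_left, Real.sq_sqrt (mul_nonneg (D.pos_σ hk hpos).le hτ)]

theorem τ_nonneg_of_hasMeasure (D : GapData k β S m σ τ p₀ p₁ p₂) (h : HasMeasure k β) :
    0 ≤ τ := by
  obtain ⟨x, y, μ, hμ⟩ := h
  rw [← D.moment_p₂_sq x y]
  refine hμ.moment_sq_nonneg ?_
  have : p₂ = X ^ k - (X ^ k - p₂) := by ring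
  rw [this]
  exact (monic_X_pow_sub_of_degree_lt
    (D.degree₂.trans_le (by exact_mod_cast (Nat.sub_le k 2)))).2.le

end GapData

/-! ### Linear systems, Moore–Penrose inverses and rank conditions -/

theorem mulVec_pinv_mulVec {m n : Type*} [Fintype m] [Fintype n] (A : Matrix m n ℝ)
    {b : m → ℝ} (hb : ∃ a, A.mulVec a = b) : A.mulVec ((pinv A).mulVec b) = b := by
  obtain ⟨a, rfl⟩ := hb
  rw [Matrix.mulVec_mulVec, Matrix.mulVec_mulVec,
    (isMoorePenrose_pinv A).mul_mul_self]

/-- If the columns of `M` selected by `f` already have the rank of `M`, every column of `M` is a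
combination of them. -/
theorem exists_submatrix_mulVec_eq_col {l m n : Type*} [Fintype l] [Fintype m] [Fintype n]
    {M : Matrix l m ℝ} {f : n → m} (h : M.rank ≤ (M.submatrix id f).rank) (j : m) :
    ∃ e, (M.submatrix id f).mulVec e = M.col j := by
  have hle : Submodule.span ℝ (Set.range (M.submatrix id f).col) ≤
      Submodule.span ℝ (Set.range M.col) :=
    Submodule.span_mono (by rintro _ ⟨i, rfl⟩; exact ⟨f i, rfl⟩)
  rw [Matrix.rank_eq_finrank_span_cols, Matrix.rank_eq_finrank_span_cols] at h
  have heq := Submodule.eq_of_le_of_finrank_le hle h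
  have hmem : M.col j ∈ Submodule.span ℝ (Set.range M.col) :=
    Submodule.subset_span ⟨j, rfl⟩
  rw [← heq, ← Matrix.range_mulVecLin] at hmem
  obtain ⟨e, he⟩ := hmem
  exact ⟨e, he⟩

/-- A bordered matrix with the rank of its upper left block: the border column is a combination
of the other columns. -/
theorem exists_mulVec_eq_of_rank_fromBlocks {n : Type*} [Fintype n] {A : Matrix n n ℝ}
    {b c : n → ℝ} {d : ℝ}
    (h : (Matrix.fromBlocks A (Matrix.replicateCol Unit b) (Matrix.replicateRow Unit c)
      (Matrix.of fun _ _ => d)).rank ≤ A.rank) :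
    ∃ e, A.mulVec e = b ∧ dotProduct c e = d := by
  set M := Matrix.fromBlocks A (Matrix.replicateCol Unit b) (Matrix.replicateRow Unit c)
    (Matrix.of fun _ _ => d)
  have hA : A.rank ≤ (M.submatrix id Sum.inl).rank :=
    Matrix.rank_submatrix_le (M.submatrix id Sum.inl) Sum.inl id
  obtain ⟨e, he⟩ := exists_submatrix_mulVec_eq_col (h.trans hA) (Sum.inr ())
  refine ⟨e, funext fun i => ?_, ?_⟩
  · exact congrFun he (Sum.inl i)
  · exact congrFun he (Sum.inr ())

theorem exists_mulVec_eq_of_rank_fromCols {l n : Type*} [Fintype l] [Fintype n]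
    {A : Matrix l n ℝ} {b : l → ℝ}
    (h : (Matrix.fromCols A (Matrix.replicateCol Unit b)).rank ≤ A.rank) :
    ∃ e, A.mulVec e = b := by
  obtain ⟨e, he⟩ := exists_submatrix_mulVec_eq_col
    (M := Matrix.fromCols A (Matrix.replicateCol Unit b)) (f := Sum.inl) h (Sum.inr ())
  exact ⟨e, he⟩

/-! ### The orthogonal polynomials in terms of Schur complements -/

theorem moment_X_pow_sub_vecPoly {n : ℕ} (γ : ℕ → ℝ) (a : Fin n → ℝ) (d j : ℕ) :
    moment γ ((X ^ d - vecPoly a) * X ^ j) = γ (d + j) - ∑ i, a i * γ (i + j) := by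
  rw [sub_mul, map_sub, moment_vecPoly_mul_X_pow, ← pow_add, moment_X_pow]

theorem schurTilde_eq {k : ℕ} (hk : 2 < k) (β : ℕ → ℝ) : schurTilde k β =
    β (2 * k - 4) - dotProduct (wVec k β) ((pinv (Ahat k β)).mulVec (wVec k β)) := by
  rw [schurTilde, Atilde_eq_fromBlocks hk, schurCompl, Matrix.toBlocks_fromBlocks₁₁,
    Matrix.toBlocks_fromBlocks₁₂, Matrix.toBlocks_fromBlocks₂₁, Matrix.toBlocks_fromBlocks₂₂,
    Matrix.mul_assoc]
  rfl

theorem schurCorner_eq (k : ℕ) (β : ℕ → ℝ) : schurCorner k β =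
    β (2 * k) - dotProduct (uVec k β) ((pinv (Ahat k β)).mulVec (uVec k β)) := by
  rw [schurCorner, Acorner, schurCompl, Matrix.toBlocks_fromBlocks₁₁,
    Matrix.toBlocks_fromBlocks₁₂, Matrix.toBlocks_fromBlocks₂₁, Matrix.toBlocks_fromBlocks₂₂,
    Matrix.mul_assoc]
  rfl

theorem gapData_of_solvable {k : ℕ} (hk : 2 < k) {β : ℕ → ℝ}
    (hs : ∃ a, (Atilde k β).mulVec a = sVec k β) (hw : ∃ a, (Ahat k β).mulVec a = wVec k β)
    (hu : ∃ a, (Ahat k β).mulVec a = uVec k β) :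
    GapData k β (sTerm k β) (uwTerm k β) (schurTilde k β) (schurCorner k β)
      (X ^ (k - 1) - vecPoly ((pinv (Atilde k β)).mulVec (sVec k β)))
      (X ^ (k - 2) - vecPoly ((pinv (Ahat k β)).mulVec (wVec k β)))
      (X ^ k - vecPoly ((pinv (Ahat k β)).mulVec (uVec k β))) := by
  have hs' := mulVec_pinv_mulVec _ hs
  have hw' := mulVec_pinv_mulVec _ hw
  have hu' := mulVec_pinv_mulVec _ hu
  have h1 : k - 2 + 1 = k - 1 := by omega
  have h2 : k - 3 + 1 = k - 2 := by omega
  rw [sTerm, uwTerm, schurTilde_eq hk, schurCorner_eq]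
  generalize (pinv (Atilde k β)).mulVec (sVec k β) = a at *
  generalize (pinv (Ahat k β)).mulVec (wVec k β) = e at *
  generalize (pinv (Ahat k β)).mulVec (uVec k β) = f at *
  have da : (vecPoly a).degree < (k - 1 : ℕ) := h1 ▸ degree_vecPoly_lt a
  have de : (vecPoly e).degree < (k - 2 : ℕ) := h2 ▸ degree_vecPoly_lt e
  have df : (vecPoly f).degree < (k - 2 : ℕ) := h2 ▸ degree_vecPoly_lt f
  have fill : ∀ x y i, i < 2 * k - 2 → fillGaps k β x y i = β i :=
    fun x y i hi => fillGaps_eq (by omega) (by omega)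
  -- moments not involving the gaps are those of `β`
  have hsum : ∀ (x y : ℝ) {n : ℕ} (b : Fin n → ℝ) (j : ℕ), n + j ≤ 2 * k - 2 →
      ∑ i, b i * fillGaps k β x y (i + j) = ∑ i, b i * β (i + j) := fun x y n b j hj =>
    Finset.sum_congr rfl fun i _ => by rw [fill x y _ (by have := i.2; omega)]
  refine
    { monic₀ := (monic_X_pow_sub_of_degree_lt da).1
      natDegree₀ := (monic_X_pow_sub_of_degree_lt da).2
      monic₁ := (monic_X_pow_sub_of_degree_lt de).1
      natDegree₁ := (monic_X_pow_sub_of_degree_lt de).2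
      degree₂ := by rw [sub_sub_cancel]; exact df
      orth₀ := fun x y j hj => ?_
      val₀ := fun x y => ?_
      orth₁ := fun x y j hj => ?_
      val₁ := fun x y => ?_
      cross₁ := fun x y => ?_
      orth₂ := fun x y j hj => ?_
      val₂ := fun x y => ?_ }
  all_goals rw [moment_X_pow_sub_vecPoly, hsum x y _ _ (by omega)]
  · have := congrFun hs' ⟨j, by omega⟩
    rw [Atilde, hankel_mulVec, moment_vecPoly_mul_X_pow] at this
    rw [this, sVec, fill x y _ (by omega), sub_self]
  · have : k - 1 + (k - 1) = 2 * k - 2 := by omega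
    rw [this, fillGaps, if_pos rfl]
    simp only [dotProduct, sVec, mul_comm, add_comm]
  · have := congrFun hw' ⟨j, by omega⟩
    rw [Ahat, hankel_mulVec, moment_vecPoly_mul_X_pow] at this
    rw [this, wVec, fill x y _ (by omega), sub_self]
  · have : k - 2 + (k - 2) = 2 * k - 4 := by omega
    rw [this, fill x y _ (by omega)]
    simp only [dotProduct, wVec, mul_comm, add_comm]
  · have : k - 2 + k = 2 * k - 2 := by omega
    rw [this, fillGaps, if_pos rfl]
    simp only [dotProduct, uVec, mul_comm, add_comm]
  · have := congrFun hu' ⟨j, by omega⟩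
    rw [Ahat, hankel_mulVec, moment_vecPoly_mul_X_pow] at this
    rw [this, uVec, fill x y _ (by omega), sub_self]
  · rw [← two_mul, fillGaps_eq (by omega) (by omega)]
    simp only [dotProduct, uVec, mul_comm, add_comm]

theorem gapData_of_posOn {k : ℕ} (hk : 2 < k) {β : ℕ → ℝ} (hpos : PosOn β (k - 1)) :
    GapData k β (sTerm k β) (uwTerm k β) (schurTilde k β) (schurCorner k β)
      (X ^ (k - 1) - vecPoly ((pinv (Atilde k β)).mulVec (sVec k β)))
      (X ^ (k - 2) - vecPoly ((pinv (Ahat k β)).mulVec (wVec k β)))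
      (X ^ k - vecPoly ((pinv (Ahat k β)).mulVec (uVec k β))) := by
  have h1 : (Atilde k β).PosDef := posDef_hankel_iff.2 (hpos.mono (by omega))
  have h2 : (Ahat k β).PosDef := posDef_hankel_iff.2 (hpos.mono (by omega))
  exact gapData_of_solvable hk
    (Matrix.mulVec_surjective_iff_isUnit.2 h1.isUnit _)
    (Matrix.mulVec_surjective_iff_isUnit.2 h2.isUnit _)
    (Matrix.mulVec_surjective_iff_isUnit.2 h2.isUnit _)

theorem gapData_two {β : ℕ → ℝ} (hβ : 0 < β 0) :
    GapData 2 β (β 1 ^ 2 / β 0) 0 (β 0) (β 4) (X - C (β 1 / β 0)) 1 (X ^ 2) := by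
  refine
    { monic₀ := monic_X_sub_C _
      natDegree₀ := natDegree_X_sub_C _
      monic₁ := monic_one
      natDegree₁ := natDegree_one
      degree₂ := by simp
      orth₀ := fun x y j hj => ?_
      val₀ := fun x y => ?_
      orth₁ := fun x y j hj => by omega
      val₁ := fun x y => ?_
      cross₁ := fun x y => ?_
      orth₂ := fun x y j hj => by omega
      val₂ := fun x y => ?_ }
  · obtain rfl : j = 0 := by omega
    rw [sub_mul, map_sub, moment_C_mul, ← pow_succ', moment_X_pow, moment_X_pow]
    simp only [fillGaps]
    norm_num
    field_simp
    ring
  · rw [sub_mul, map_sub, moment_C_mul, ← pow_succ', moment_X_pow, moment_X_pow]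
    simp only [fillGaps]
    norm_num
    ring
  · rw [one_mul, moment_X_pow]; simp [fillGaps]
  · rw [one_mul, moment_X_pow]; simp [fillGaps]
  · rw [← pow_add, moment_X_pow]; simp [fillGaps]

/-! ### Partial positive semidefiniteness -/

/-- A completion of a partially positive semidefinite Hankel matrix is nonnegative on polynomials
avoiding the gaps. -/
theorem moment_sq_nonneg_of_isPPSD {k : ℕ} {β : ℕ → ℝ} (h : IsPPSD (partialHankel k β))
    (x y : ℝ) {f : ℝ[X]} (hf : f.natDegree ≤ k) (h1 : f.coeff (k - 1) = 0)
    (h2 : f.coeff k = 0 ∨ f.coeff (k - 2) = 0) : 0 ≤ moment (fillGaps k β x y) (f * f) := by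
  classical
  set a : Fin (k + 1) → ℝ := fun i => f.coeff i with ha
  have hfa : f = vecPoly a := (vecPoly_coeff
    (degree_le_natDegree.trans_lt (by exact_mod_cast Nat.lt_succ_of_le hf))).symm
  set Q : Finset (Fin (k + 1)) := Finset.univ.filter fun i => a i ≠ 0 with hQ
  have hspec : ∀ i ∈ Q, ∀ j ∈ Q, (i : ℕ) + j ≠ 2 * k - 2 ∧ (i : ℕ) + j ≠ 2 * k - 1 := by
    intro i hi j hj
    have hi' : f.coeff i ≠ 0 := (Finset.mem_filter.1 hi).2
    have hj' : f.coeff j ≠ 0 := (Finset.mem_filter.1 hj).2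
    have e1 : (i : ℕ) ≠ k - 1 := fun e => hi' (by rw [e, h1])
    have e2 : (j : ℕ) ≠ k - 1 := fun e => hj' (by rw [e, h1])
    have e3 : ¬ ((i : ℕ) = k ∧ (j : ℕ) = k - 2) := by
      rintro ⟨e, e'⟩
      rw [e] at hi'; rw [e'] at hj'
      exact h2.elim hi' hj'
    have e4 : ¬ ((j : ℕ) = k ∧ (i : ℕ) = k - 2) := by
      rintro ⟨e, e'⟩
      rw [e] at hj'; rw [e'] at hi'
      exact h2.elim hj' hi'
    have := i.2
    have := j.2
    omega
  have hP := h.2 Q fun i hi j hj => by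
    obtain ⟨n1, n2⟩ := hspec i hi j hj
    simp [partialHankel, n1, n2]
  have hnn := hP.dotProduct_mulVec_nonneg fun i : Q => a i
  have hentry : ∀ i j : Q, (partialHankel k β i j).getD 0 = fillGaps k β x y (i + j) := by
    intro i j
    obtain ⟨n1, n2⟩ := hspec i i.2 j j.2
    rw [fillGaps_eq n1 n2]
    simp [partialHankel, n1, n2]
  have hsum : ∀ g : Fin (k + 1) → ℝ, ∑ i, a i * g i = ∑ i : Q, a i * g i := by
    intro g
    rw [Finset.sum_coe_sort Q fun i => a i * g i, hQ, Finset.sum_filter]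
    refine Finset.sum_congr rfl fun i _ => ?_
    split_ifs with hi
    · rfl
    · rw [not_not.1 hi, zero_mul]
  have hval : moment (fillGaps k β x y) (f * f) =
      ∑ i : Q, a i * ∑ j : Q, a j * fillGaps k β x y (i + j) := by
    rw [hfa, moment_vecPoly_mul, hsum]
    refine Finset.sum_congr rfl fun i _ => ?_
    rw [mul_comm (X ^ _), moment_vecPoly_mul_X_pow, hsum]
    simp only [add_comm]
  rw [hval]
  simpa [dotProduct, Matrix.mulVec, hentry, mul_comm] using hnn

theorem moment_sq_nonneg_of_degree_lt {k : ℕ} (hk : 2 ≤ k) {β : ℕ → ℝ}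
    (h : IsPPSD (partialHankel k β)) {f : ℝ[X]} (hf : f.degree < (k - 1 : ℕ)) :
    0 ≤ moment β (f * f) := by
  by_cases h0 : f = 0
  · simp [h0]
  have hn := (natDegree_lt_iff_degree_lt h0).2 hf
  have := moment_sq_nonneg_of_isPPSD h 0 0 (f := f) (by omega)
    (coeff_eq_zero_of_natDegree_lt (by omega)) (Or.inl (coeff_eq_zero_of_natDegree_lt (by omega)))
  rwa [moment_fillGaps_of_natDegree_lt] at this
  exact natDegree_mul_le.trans_lt (by omega)

theorem GapData.τ_nonneg_of_isPPSD {k : ℕ} {β : ℕ → ℝ} {S m σ τ : ℝ} {p₀ p₁ p₂ : ℝ[X]}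
    (D : GapData k β S m σ τ p₀ p₁ p₂) (hk : 2 ≤ k) (h : IsPPSD (partialHankel k β)) :
    0 ≤ τ := by
  have hp : p₂ = X ^ k - (X ^ k - p₂) := by ring
  have hz : ∀ i, k - 2 ≤ i → i < k → p₂.coeff i = 0 := fun i hi hi' => by
    rw [hp, coeff_sub, coeff_X_pow, if_neg hi'.ne,
      (degree_lt_iff_coeff_zero _ _).1 D.degree₂ i hi, sub_zero]
  rw [← D.moment_p₂_sq 0 0]
  refine moment_sq_nonneg_of_isPPSD h 0 0 ?_ (hz _ (by omega) (by omega))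
    (Or.inr (hz _ le_rfl (by omega)))
  rw [hp]
  exact (monic_X_pow_sub_of_degree_lt
    (D.degree₂.trans_le (by exact_mod_cast (Nat.sub_le k 2)))).2.le

theorem Represents.isPPSD {k : ℕ} {β : ℕ → ℝ} {x y : ℝ} {μ : Measure ℝ}
    (h : Represents μ k (fillGaps k β x y)) : IsPPSD (partialHankel k β) := by
  refine ⟨fun i j => by simp [partialHankel, add_comm], fun Q hQ => ?_⟩
  have hpsd : (hankel (fillGaps k β x y) k).PosSemidef := by
    refine .of_dotProduct_mulVec_nonneg (hankel_isHermitian _ _) fun a => ?_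
    rw [star_trivial, dotProduct_hankel_mulVec]
    refine h.moment_sq_nonneg ?_
    by_cases h0 : vecPoly a = 0
    · simp [h0]
    exact Nat.lt_succ_iff.1 ((natDegree_lt_iff_degree_lt h0).2 (degree_vecPoly_lt a))
  convert! hpsd.submatrix (Subtype.val : Q → Fin (k + 1)) using 1
  ext i j
  have hij := hQ i i.2 j j.2
  by_cases hgap : ((i : Fin (k + 1)) : ℕ) + (j : Fin (k + 1)) = 2 * k - 2 ∨
      ((i : Fin (k + 1)) : ℕ) + (j : Fin (k + 1)) = 2 * k - 1
  · simp [partialHankel, hgap] at hij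
  · have := hgap
    push Not at this
    simp [partialHankel, hgap, hankel, fillGaps_eq this.1 this.2]

/-! ### Finitely atomic sequences -/

namespace IsQuadrature

variable {γ : ℕ → ℝ} {N : ℕ} {S : Finset ℝ} {c : ℝ → ℝ}

theorem eval_eq_zero_of_sum_eq_zero (h : IsQuadrature γ N S c) {f : ℝ[X]}
    (hf : ∑ t ∈ S, c t * (f.eval t * f.eval t) = 0) {t : ℝ} (ht : t ∈ S) : f.eval t = 0 := by
  have := (Finset.sum_eq_zero_iff_of_nonneg fun t ht =>
    mul_nonneg (h.1 t ht).le (mul_self_nonneg (f.eval t))).1 hf t ht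
  simpa [(h.1 t ht).ne'] using this

theorem posOn (h : IsQuadrature γ N S c) (hN : 2 * S.card ≤ N + 1) : PosOn γ S.card := by
  intro f hf hf0
  have hfn := (natDegree_lt_iff_degree_lt hf0).2 hf
  rw [h.moment_eq (natDegree_mul_le.trans (by omega))]
  simp only [eval_mul]
  refine lt_of_le_of_ne (Finset.sum_nonneg fun t ht =>
    mul_nonneg (h.1 t ht).le (mul_self_nonneg _)) fun h0 => hf0 ?_
  exact eq_zero_of_degree_lt_of_eval_finset_eq_zero S hf fun t ht =>
    h.eval_eq_zero_of_sum_eq_zero h0.symm ht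

/-- A polynomial orthogonal to as many degrees as there are atoms vanishes at all atoms. -/
theorem eval_eq_zero (h : IsQuadrature γ N S c) {f : ℝ[X]}
    (hf : ∀ j < S.card, moment γ (f * X ^ j) = 0) (hN : f.natDegree + S.card ≤ N + 1) {t : ℝ}
    (ht : t ∈ S) : f.eval t = 0 := by
  have hinj : Set.InjOn (id : ℝ → ℝ) S := Function.injective_id.injOn
  set g := Lagrange.interpolate S id fun t => f.eval t with hg
  have hgd : g.degree < S.card := Lagrange.degree_interpolate_lt _ hinj
  have hfg := moment_mul_eq_zero hf hgd
  have hdeg : (f * g).natDegree ≤ N := by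
    by_cases h0 : g = 0
    · simp [h0]
    have := (natDegree_lt_iff_degree_lt h0).2 hgd
    exact natDegree_mul_le.trans (by omega)
  rw [h.moment_eq hdeg] at hfg
  refine h.eval_eq_zero_of_sum_eq_zero ?_ ht
  rw [← hfg]
  refine Finset.sum_congr rfl fun t ht => ?_
  have : g.eval t = f.eval t := Lagrange.eval_interpolate_at_node (fun t => f.eval t) hinj ht
  rw [eval_mul, this]

theorem moment_mul_eq_zero_of_eval (h : IsQuadrature γ N S c) {f g : ℝ[X]}
    (hf : ∀ t ∈ S, f.eval t = 0) (hN : f.natDegree + g.natDegree ≤ N) :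
    moment γ (f * g) = 0 := by
  rw [h.moment_eq (natDegree_mul_le.trans hN)]
  exact Finset.sum_eq_zero fun t ht => by rw [eval_mul, hf t ht, zero_mul, mul_zero]

theorem rank_le {l n : Type*} [Fintype l] [Fintype n] (h : IsQuadrature γ N S c)
    {M : Matrix l n ℝ} (a : l → ℕ) (b : n → ℕ)
    (hM : ∀ i j, a i + b j ≤ N ∧ M i j = γ (a i + b j)) : M.rank ≤ S.card := by
  have hfac : M = (Matrix.of fun i (t : S) => c t * (t : ℝ) ^ a i) *
      (Matrix.of fun (t : S) j => (t : ℝ) ^ b j) := by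
    ext i j
    rw [(hM i j).2, h.2 _ (hM i j).1, Matrix.mul_apply, ← Finset.sum_coe_sort]
    exact Finset.sum_congr rfl fun t _ => by
      rw [Matrix.of_apply, Matrix.of_apply, pow_add, mul_assoc]
  rw [hfac]
  refine (Matrix.rank_mul_le_left _ _).trans ((Matrix.rank_le_card_width _).trans ?_)
  rw [Fintype.card_coe]

end IsQuadrature

theorem le_rank_hankel {γ : ℕ → ℝ} {r m : ℕ} (hpos : PosOn γ r) (hr : r ≤ m + 1) :
    r ≤ (hankel γ m).rank := by
  rcases r with _ | r
  · exact Nat.zero_le _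
  have hu := Matrix.rank_of_isUnit _ (posDef_hankel_iff.2 hpos).isUnit
  rw [Fintype.card_fin] at hu
  have hsub : hankel γ r = (hankel γ m).submatrix (Fin.castLE hr) (Fin.castLE hr) := by
    ext i j
    simp [hankel]
  rw [← hu, hsub]
  exact Matrix.rank_submatrix_le _ _ _

/-! ### The singular case -/

/-- The rank condition of the singular case: bordering `A_{β̂}` to `A_{β̃}` or to `Ã`, and adjoining
the column `sᵀ` to `A_{β̃}`, does not increase the rank. -/
def FlatRanks (k : ℕ) (β : ℕ → ℝ) : Prop :=
  (Ahat k β).rank = (Atilde k β).rank ∧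
    (Atilde k β).rank =
      (Matrix.fromCols (Atilde k β) (Matrix.replicateCol Unit (sVec k β))).rank ∧
    (Matrix.fromCols (Atilde k β) (Matrix.replicateCol Unit (sVec k β))).rank =
      (Acorner k β).rank

/-- For a symmetric matrix, `b A⁺ bᵀ` can be computed from any solution of `A e = b`. -/
theorem dotProduct_pinv_mulVec {n : Type*} [Fintype n] {A : Matrix n n ℝ} (hA : A.IsHermitian)
    {b e : n → ℝ} (he : A.mulVec e = b) :
    dotProduct b ((pinv A).mulVec b) = dotProduct b e := by
  have hT : A.transpose = A := by
    rw [← Matrix.conjTranspose_eq_transpose_of_trivial]; exact hA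
  have h := mulVec_pinv_mulVec A ⟨e, he⟩
  calc dotProduct b ((pinv A).mulVec b)
      = dotProduct (A.mulVec e) ((pinv A).mulVec b) := by rw [he]
    _ = dotProduct e (A.mulVec ((pinv A).mulVec b)) := by
        rw [Matrix.dotProduct_mulVec e, ← Matrix.mulVec_transpose, hT]
    _ = dotProduct b e := by rw [h, dotProduct_comm]

theorem FlatRanks.gapData {k : ℕ} (hk : 2 < k) {β : ℕ → ℝ} (h : FlatRanks k β) :
    schurTilde k β = 0 ∧ schurCorner k β = 0 ∧ ∃ p₀ p₁ p₂,
      GapData k β (sTerm k β) (uwTerm k β) (schurTilde k β) (schurCorner k β) p₀ p₁ p₂ := by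
  obtain ⟨h1, h2, h3⟩ := h
  have hw : ∃ e, (Ahat k β).mulVec e = wVec k β ∧ dotProduct (wVec k β) e = β (2 * k - 4) := by
    refine exists_mulVec_eq_of_rank_fromBlocks ?_
    rw [← Atilde_eq_fromBlocks hk, h1]
    exact Matrix.rank_submatrix_le _ _ _
  have hu : ∃ e, (Ahat k β).mulVec e = uVec k β ∧ dotProduct (uVec k β) e = β (2 * k) :=
    exists_mulVec_eq_of_rank_fromBlocks (h1.trans (h2.trans h3)).ge
  have hs := exists_mulVec_eq_of_rank_fromCols h2.ge
  obtain ⟨e, he, he'⟩ := hw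
  obtain ⟨f, hf, hf'⟩ := hu
  refine ⟨?_, ?_, _, _, _, gapData_of_solvable hk hs ⟨e, he⟩ ⟨f, hf⟩⟩
  · have hA : (Ahat k β).IsHermitian := hankel_isHermitian _ _
    rw [schurTilde_eq hk, dotProduct_pinv_mulVec hA he, he', sub_self]
  · have hA : (Ahat k β).IsHermitian := hankel_isHermitian _ _
    rw [schurCorner_eq, dotProduct_pinv_mulVec hA hf, hf', sub_self]

/-- If some completion has a representing measure and `A_{β̃}` is singular, the measure has
`r ≤ k - 2` atoms, all matrices in question have rank `r`, and `p₀`, `p₁` vanish on the atoms. -/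
theorem singular_of_hasMeasure {k : ℕ} (hk : 2 < k) {β : ℕ → ℝ} (hpos : ¬ PosOn β (k - 1))
    (h : HasMeasure k β) :
    FlatRanks k β ∧ sTerm k β = uwTerm k β ∧ HasAtomicMeasure (seqRank β (k - 2)) k β := by
  obtain ⟨x, y, μ, hμ⟩ := h
  have hpos' : ¬ PosOn (fillGaps k β x y) (k - 2 + 1) := by
    rwa [posOn_fillGaps_iff (by omega), (by omega : k - 2 + 1 = k - 1)]
  obtain ⟨T, c, hT, hquad⟩ := hμ.exists_quadrature_of_not_posOn (by omega) hpos'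
  have hposT := hquad.posOn (by omega)
  have hposT' : PosOn β T.card := (posOn_fillGaps_iff (by omega)).1 hposT
  have hfill : ∀ i, i < 2 * k - 2 → β i = fillGaps k β x y i := fun i hi =>
    (fillGaps_eq (by omega) (by omega)).symm
  have hfill' : β (2 * k) = fillGaps k β x y (2 * k) :=
    (fillGaps_eq (by omega) (by omega)).symm
  -- the rank of each matrix lies between `rank Ahat` and the number of atoms
  have hlow : T.card ≤ (Ahat k β).rank := le_rank_hankel hposT' (by omega)
  have hAA : (Ahat k β).rank ≤ (Atilde k β).rank := by
    have : Ahat k β = (Atilde k β).submatrix (fun i => splitLast k (Sum.inl i))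
        (fun i => splitLast k (Sum.inl i)) := by
      ext i j
      simp [Ahat, Atilde, hankel, splitLast]
    rw [this]
    exact Matrix.rank_submatrix_le _ _ _
  have hAs : (Atilde k β).rank ≤
      (Matrix.fromCols (Atilde k β) (Matrix.replicateCol Unit (sVec k β))).rank :=
    Matrix.rank_submatrix_le
      (Matrix.fromCols (Atilde k β) (Matrix.replicateCol Unit (sVec k β))) id Sum.inl
  have hAc : (Ahat k β).rank ≤ (Acorner k β).rank :=
    Matrix.rank_submatrix_le (Acorner k β) Sum.inl Sum.inl
  have hus : (Matrix.fromCols (Atilde k β) (Matrix.replicateCol Unit (sVec k β))).rank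
      ≤ T.card := by
    refine hquad.rank_le (fun i => (i : ℕ)) (Sum.elim (fun j => (j : ℕ)) fun _ => k - 1) ?_
    rintro i (j | j) <;> have := i.2
    · have := j.2
      exact ⟨by simp; omega, by simpa [Atilde, hankel] using hfill _ (by omega)⟩
    · refine ⟨by simp; omega, ?_⟩
      simpa [sVec, add_comm] using hfill (k - 1 + i) (by omega)
  have huc : (Acorner k β).rank ≤ T.card := by
    refine hquad.rank_le (Sum.elim (fun i => (i : ℕ)) fun _ => k)
      (Sum.elim (fun i => (i : ℕ)) fun _ => k) ?_
    rintro (i | i) (j | j)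
    · have := i.2; have := j.2
      exact ⟨by simp; omega, by simpa [Acorner, Ahat, hankel] using hfill _ (by omega)⟩
    · have := i.2
      refine ⟨by simp; omega, ?_⟩
      simpa [Acorner, uVec, add_comm] using hfill (k + i) (by omega)
    · have := j.2
      refine ⟨by simp; omega, ?_⟩
      simpa [Acorner, uVec] using hfill (k + j) (by omega)
    · refine ⟨by simp; omega, ?_⟩
      simpa [Acorner, ← two_mul] using hfill'
  have hflat : FlatRanks k β := ⟨by omega, by omega, by omega⟩
  obtain ⟨-, -, p₀, p₁, p₂, D⟩ := hflat.gapData hk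
  have hy : y = sTerm k β := by
    have h0 := hquad.moment_mul_eq_zero_of_eval (f := p₀) (g := X ^ (k - 1))
      (fun t ht => hquad.eval_eq_zero (fun j hj => D.orth₀ x y j (by omega))
        (by rw [D.natDegree₀]; omega) ht) (by rw [D.natDegree₀, natDegree_X_pow]; omega)
    rw [D.val₀] at h0
    linarith
  have hy' : y = uwTerm k β := by
    have h0 := hquad.moment_mul_eq_zero_of_eval (f := p₁) (g := X ^ k)
      (fun t ht => hquad.eval_eq_zero (fun j hj => D.orth₁ x y j (by omega))
        (by rw [D.natDegree₁]; omega) ht) (by rw [D.natDegree₁, natDegree_X_pow]; omega)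
    rw [D.cross₁] at h0
    linarith
  refine ⟨hflat, hy.symm.trans hy', ?_⟩
  have hseq : seqRank β (k - 2) = T.card := by
    refine seqRank_eq_natDegree (p := Lagrange.nodal T (id : ℝ → ℝ)) Lagrange.nodal_monic
      Lagrange.natDegree_nodal hT hposT' fun j hj => ?_
    have hd : (Lagrange.nodal T (id : ℝ → ℝ)).natDegree + (X ^ j : ℝ[X]).natDegree
        < 2 * k - 2 := by
      rw [Lagrange.natDegree_nodal, natDegree_X_pow]; omega
    rw [← moment_fillGaps_of_natDegree_lt (k := k) β x y (natDegree_mul_le.trans_lt hd)]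
    exact hquad.moment_mul_eq_zero_of_eval
      (fun t ht => Lagrange.eval_nodal_at_node (v := (id : ℝ → ℝ)) ht) (by omega)
  rw [hseq]
  exact hasAtomicMeasure_iff.2 ⟨x, y, T, c, rfl, hquad⟩

/-- A degenerate positive semidefinite Hankel form has a monic polynomial `p` in its kernel such
that the form is positive definite below the degree of `p`. -/
theorem exists_monic_orthogonal {γ : ℕ → ℝ} {n : ℕ}
    (hpsd : ∀ f : ℝ[X], f.degree < n → 0 ≤ moment γ (f * f)) (hpos : ¬ PosOn γ n) :
    ∃ p : ℝ[X], p.Monic ∧ p.natDegree < n ∧ PosOn γ p.natDegree ∧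
      ∀ j < n, moment γ (p * X ^ j) = 0 := by
  classical
  have hex : ∃ r, ¬ PosOn γ r := ⟨n, hpos⟩
  obtain ⟨r, hr⟩ : ∃ r, Nat.find hex = r + 1 := Nat.exists_eq_succ_of_ne_zero fun h0 => by
    have := Nat.find_spec hex
    rw [h0] at this
    refine this fun f hf hf0 => (hf0 ?_).elim
    simpa [Nat.WithBot.lt_zero_iff] using hf
  have hrn : r + 1 ≤ n := hr ▸ Nat.find_min' hex hpos
  have hposr : PosOn γ r := not_not.1 (Nat.find_min hex (by omega))
  have hnot : ¬ PosOn γ (r + 1) := hr ▸ Nat.find_spec hex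
  rw [PosOn] at hnot
  push Not at hnot
  obtain ⟨f, hfd, hf0, hf⟩ := hnot
  have hfn : f.natDegree = r := by
    have h1 := (natDegree_lt_iff_degree_lt hf0).2 hfd
    by_contra hne
    exact (hposr f ((natDegree_lt_iff_degree_lt hf0).1 (by omega)) hf0).not_ge hf
  have hfdn : f.degree < n := hfd.trans_le (by exact_mod_cast hrn)
  have hff : moment γ (f * f) = 0 := le_antisymm hf (hpsd f hfdn)
  have hker : ∀ j < n, moment γ (f * X ^ j) = 0 := by
    intro j hj
    by_contra hb
    set b := moment γ (f * X ^ j)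
    set G := moment γ (X ^ j * X ^ j)
    -- at this `a`, the form takes the value `-1` on `a f + X ^ j`
    set a : ℝ := -(G + 1) / (2 * b) with ha
    have h := hpsd (a • f + X ^ j) ((degree_add_le _ _).trans_lt (max_lt
      ((degree_smul_le _ _).trans_lt hfdn) (by rw [degree_X_pow]; exact_mod_cast hj)))
    have hexp : (a • f + X ^ j) * (a • f + X ^ j) =
        C (a ^ 2) * (f * f) + C (2 * a) * (f * X ^ j) + X ^ j * X ^ j := by
      rw [smul_eq_C_mul, C_mul, C_pow, map_ofNat]; ring
    rw [hexp, map_add, map_add, moment_C_mul, moment_C_mul, hff] at h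
    have : 2 * a * b = -(G + 1) := by rw [ha]; field_simp
    change 0 ≤ a ^ 2 * 0 + 2 * a * b + G at h
    linarith
  have hl : f.leadingCoeff⁻¹ ≠ 0 := inv_ne_zero (leadingCoeff_ne_zero.2 hf0)
  have hnd : (C f.leadingCoeff⁻¹ * f).natDegree = r := by rw [natDegree_C_mul hl, hfn]
  refine ⟨C f.leadingCoeff⁻¹ * f, ?_, by omega, by rwa [hnd], fun j hj => ?_⟩
  · rw [mul_comm]; exact monic_mul_leadingCoeff_inv hf0
  · rw [mul_assoc, moment_C_mul, hker j hj, mul_zero]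

/-- In the singular case with `σ = τ = 0`, the minimal recursion `p` of `β̃` divides `p₁` and `p₂`,
and the moments of these multiples show that `p` is a recursion for all given data. -/
theorem GapData.hasAtomicMeasure_of_singular {k : ℕ} {β : ℕ → ℝ} {S m : ℝ} {p₀ p₁ p₂ : ℝ[X]}
    (D : GapData k β S m 0 0 p₀ p₁ p₂) (hk : 2 ≤ k) (hpos : ¬ PosOn β (k - 1))
    (hpsd : ∀ f : ℝ[X], f.degree < (k - 1 : ℕ) → 0 ≤ moment β (f * f)) :
    HasAtomicMeasure (seqRank β (k - 2)) k β := by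
  obtain ⟨p, hp, hpn, hposr, hker⟩ := exists_monic_orthogonal hpsd hpos
  set r := p.natDegree with hr
  have hpX : ∀ j, (p * X ^ j).natDegree = r + j := fun j => by
    rw [hp.natDegree_mul (monic_X_pow j), natDegree_X_pow]
  have hposr' : ∀ x y, PosOn (fillGaps k β x y) r := fun x y =>
    (posOn_fillGaps_iff (by omega)).2 hposr
  obtain ⟨d, hd⟩ : ∃ d, k - 2 = r + d := ⟨k - 2 - r, by omega⟩
  have hdata : ∀ x y, ∀ j < d + k, moment (fillGaps k β x y) (p * X ^ j) = 0 := by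
    intro x y
    have hker' : ∀ j < k - 1, moment (fillGaps k β x y) (p * X ^ j) = 0 := fun j hj => by
      rw [moment_fillGaps_of_natDegree_lt _ _ _ (by rw [hpX]; omega), hker j hj]
    obtain ⟨h, hh, hhd, hph⟩ := exists_eq_mul_of_orthogonal hp hr.symm D.monic₁
      (D.natDegree₁.trans hd) (hposr' x y) (fun j hj => hker' j (by omega))
      (fun j hj => D.orth₁ x y j (by omega))
    have hX : X ^ (k - 1) = p₀ + (X ^ (k - 1) - p₀) := by ring
    have hlt : (X ^ (k - 1) - p₀).degree < ((k - 1 : ℕ) : WithBot ℕ) :=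
      degree_sub_lt_of_monic (monic_X_pow _) D.monic₀ (natDegree_X_pow _) D.natDegree₀
    -- `X ^ (k-1)` may be replaced by a polynomial of smaller degree
    have hred : ∀ q : ℝ[X], q.natDegree < k - 1 →
        (∀ j < k - 1, moment (fillGaps k β x y) (q * X ^ j) = 0) →
        moment (fillGaps k β x y) (q * X ^ (k - 1)) = 0 := by
      intro q hq hqz
      rw [hX, mul_add, map_add, moment_mul_eq_zero hqz hlt, add_zero, mul_comm]
      refine moment_mul_eq_zero (D.orth₀ x y) ?_
      exact degree_le_natDegree.trans_lt (by exact_mod_cast hq)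
    have hg : ∀ i < k, moment (fillGaps k β x y) (p₁ * X ^ i) = 0 := by
      have hg' : ∀ i < k - 1, moment (fillGaps k β x y) (p₁ * X ^ i) = 0 := by
        intro i hi
        rcases (by omega : i < k - 2 ∨ i = k - 2) with h | rfl
        · exact D.orth₁ x y i h
        · exact D.val₁ x y
      intro i hi
      rcases (by omega : i < k - 1 ∨ i = k - 1) with h | rfl
      · exact hg' i h
      · exact hred _ (by rw [D.natDegree₁]; omega) hg'
    intro j
    induction j using Nat.strong_induction_on with
    | _ j ih =>
      intro hj
      rcases (by omega : j < k - 1 ∨ j = k - 1 ∨ k ≤ j) with h' | rfl | h'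
      · exact hker' j h'
      · exact hred p hpn hker'
      · obtain ⟨i, rfl⟩ : ∃ i, j = d + i := ⟨j - d, by omega⟩
        refine moment_mul_X_pow_eq_zero_of_mul hh hhd (fun l hl => ih l hl (by omega)) ?_
        rw [← hph]
        exact hg i (by omega)
  obtain ⟨y, hy⟩ := exists_forall_moment_fillGaps_eq_zero hk β (hp.mul (monic_X_pow (d + k)))
    (by rw [hpX]; omega)
  obtain ⟨x, hx⟩ := exists_moment_fillGaps_eq_zero hk β y (hp.mul (monic_X_pow (d + k + 1)))
    (by rw [hpX]; omega)
  have hrec : ∀ j < d + 2 + k, moment (fillGaps k β x y) (p * X ^ j) = 0 := by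
    intro j hj
    rcases (by omega : j < d + k ∨ j = d + k ∨ j = d + k + 1) with h | rfl | rfl
    · exact hdata x y j h
    · exact hy x
    · exact hx
  have hp₂ : p₂.Monic ∧ p₂.natDegree = k := by
    have h := monic_X_pow_sub_of_degree_lt
      (D.degree₂.trans_le (by exact_mod_cast (Nat.sub_le k 2)))
    rwa [sub_sub_cancel] at h
  obtain ⟨h, hh, hhd, hph⟩ := exists_eq_mul_of_orthogonal hp hr.symm hp₂.1 (d := d + 2)
    (by rw [hp₂.2]; omega) (hposr' x y) (fun j hj => hrec j (by omega)) (fun j hj => by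
      exact D.orth₂ x y j (by omega))
  have hlast := moment_mul_X_pow_eq_zero_of_mul hh hhd hrec (by rw [← hph]; exact D.val₂ x y)
  obtain ⟨T, c, hT, hc, hm⟩ := exists_quadrature (N := 2 * k) hp hr.symm (hposr' x y)
    (by omega) (fun j hj => by
      rcases (by omega : j < d + 2 + k ∨ j = d + 2 + k) with h | rfl
      · exact hrec j h
      · exact hlast)
  rw [seqRank_eq_natDegree hp hr.symm (by omega) hposr fun j hj => hker j (by omega)]
  exact hasAtomicMeasure_iff.2 ⟨x, y, T, c, hT, hc, hm⟩

/-! ### The characterization -/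

theorem GapData.hasAtomicMeasure_or {k : ℕ} {β : ℕ → ℝ} {S m σ τ : ℝ} {p₀ p₁ p₂ : ℝ[X]}
    (D : GapData k β S m σ τ p₀ p₁ p₂) (hk : 2 ≤ k) (hpos : PosOn β (k - 1)) (hτ : 0 ≤ τ)
    (h : S ≤ m + √(σ * τ)) : HasAtomicMeasure (k - 1) k β ∨ HasAtomicMeasure k k β := by
  rcases h.eq_or_lt with h | h
  · exact Or.inl ((D.hasAtomicMeasure_iff_eq hk hpos hτ).2 (Or.inr h))
  · exact Or.inr (D.hasAtomicMeasure_of_lt_add_sqrt hk hpos hτ h)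

theorem posOn_one {γ : ℕ → ℝ} (h : 0 < γ 0) : PosOn γ 1 := by
  intro f hf hf0
  have hfC := eq_C_of_natDegree_le_zero
    (Nat.lt_succ_iff.1 ((natDegree_lt_iff_degree_lt hf0).2 hf))
  have hc : f.coeff 0 ≠ 0 := fun h0 => hf0 (by rw [hfC, h0, C_0])
  have hff : f * f = C (f.coeff 0 * f.coeff 0) * X ^ 0 := by
    rw [pow_zero, mul_one, C_mul, ← hfC]
  rw [hff, moment_C_mul, moment_X_pow]
  exact mul_pos (mul_self_pos.2 hc) h

theorem HasMeasure.isPPSD {k : ℕ} {β : ℕ → ℝ} (h : HasMeasure k β) :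
    IsPPSD (partialHankel k β) := by
  obtain ⟨x, y, μ, hμ⟩ := h
  exact hμ.isPPSD

end

end GapHamburger

theorem theorem3p5 (k : ℕ) (hk : 1 < k) (β : ℕ → ℝ) (hβ : 0 < β 0) :
    List.TFAE
      [ HasMeasure k β,
        HasAtomicMeasure (seqRank β (k - 2)) k β ∨
          HasAtomicMeasure (seqRank β (k - 2) + 1) k β,
        IsPPSD (partialHankel k β) ∧
          ((k = 2 ∧ β 1 ^ 2 / β 0 ≤ √(β 0 * β 4)) ∨
           (2 < k ∧
            sTerm k β ≤ uwTerm k β + √(schurTilde k β * schurCorner k β) ∧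
            ((Atilde k β).PosDef ∨
             ((Ahat k β).rank = (Atilde k β).rank ∧
              (Atilde k β).rank =
                (Matrix.fromCols (Atilde k β) (Matrix.replicateCol Unit (sVec k β))).rank ∧
              (Matrix.fromCols (Atilde k β) (Matrix.replicateCol Unit (sVec k β))).rank =
                (Acorner k β).rank)))) ] ∧
    (HasMeasure k β →
      (k = 2 →
        (HasAtomicMeasure 1 k β ↔ β 1 ^ 2 / β 0 = √(β 0 * β 4)) ∧
        (β 1 ^ 2 / β 0 ≠ √(β 0 * β 4) → HasAtomicMeasure 2 k β)) ∧
      (2 < k →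
        (HasAtomicMeasure (seqRank β (k - 2)) k β ↔
          (sTerm k β = uwTerm k β - √(schurTilde k β * schurCorner k β) ∨
           sTerm k β = uwTerm k β + √(schurTilde k β * schurCorner k β))) ∧
        (¬ (sTerm k β = uwTerm k β - √(schurTilde k β * schurCorner k β) ∨
            sTerm k β = uwTerm k β + √(schurTilde k β * schurCorner k β)) →
          HasAtomicMeasure (seqRank β (k - 2) + 1) k β))) := by
  have h21 : HasAtomicMeasure (seqRank β (k - 2)) k β ∨
      HasAtomicMeasure (seqRank β (k - 2) + 1) k β → HasMeasure k β :=
    fun h => h.elim HasAtomicMeasure.hasMeasure HasAtomicMeasure.hasMeasure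
  rcases (by omega : k = 2 ∨ 2 < k) with rfl | hk2
  · have D := gapData_two hβ
    have hpos : PosOn β (2 - 1) := posOn_one hβ
    have hseq : seqRank β (2 - 2) = 1 := seqRank_eq_succ hpos
    rw [hseq] at h21 ⊢
    refine ⟨?_, fun h => ⟨fun _ => ?_, fun h => absurd h (lt_irrefl _)⟩⟩
    · tfae_have 1 → 3 := fun h => ⟨h.isPPSD, Or.inl ⟨rfl, by
        simpa using D.le_add_sqrt le_rfl hpos h⟩⟩
      tfae_have 3 → 2 := by
        rintro ⟨hP, ⟨-, h⟩ | ⟨h, -⟩⟩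
        · exact D.hasAtomicMeasure_or le_rfl hpos (D.τ_nonneg_of_isPPSD le_rfl hP)
            (by simpa using h)
        · exact absurd h (lt_irrefl _)
      tfae_have 2 → 1 := h21
      tfae_finish
    · have hτ := D.τ_nonneg_of_hasMeasure h
      have hle := D.le_add_sqrt le_rfl hpos h
      have hiff := D.hasAtomicMeasure_iff_eq le_rfl hpos hτ
      rw [zero_add] at hle hiff
      refine ⟨hiff.trans ⟨?_, Or.inr⟩, fun hne => ?_⟩
      · -- the left-hand side is nonnegative, so the minus sign forces both sides to vanish
        rintro (h0 | h0)
        · have h1 : 0 ≤ β 1 ^ 2 / β 0 := by positivity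
          have h2 := Real.sqrt_nonneg (β 0 * β 4)
          linarith
        · exact h0
      · exact D.hasAtomicMeasure_of_lt_add_sqrt le_rfl hpos hτ
          (by rw [zero_add]; exact lt_of_le_of_ne hle hne)
  · have hne2 : k ≠ 2 := hk2.ne'
    by_cases hpos : PosOn β (k - 1)
    · have D := gapData_of_posOn hk2 hpos
      have hpos' : PosOn β (k - 2 + 1) := by rwa [(by omega : k - 2 + 1 = k - 1)]
      have hseq : seqRank β (k - 2) = k - 1 := by
        rw [seqRank_eq_succ hpos']; omega
      rw [hseq, (by omega : k - 1 + 1 = k)] at h21 ⊢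
      refine ⟨?_, fun h => ⟨fun h => absurd h hne2, fun _ => ?_⟩⟩
      · tfae_have 1 → 3 := fun h => ⟨h.isPPSD, Or.inr ⟨hk2, D.le_add_sqrt hk hpos h,
          Or.inl (posDef_hankel_iff.2 hpos')⟩⟩
        tfae_have 3 → 2 := by
          rintro ⟨hP, ⟨h, -⟩ | ⟨-, h, -⟩⟩
          · exact absurd h hne2
          · exact D.hasAtomicMeasure_or hk hpos (D.τ_nonneg_of_isPPSD hk hP) h
        tfae_have 2 → 1 := h21
        tfae_finish
      · have hτ := D.τ_nonneg_of_hasMeasure h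
        refine ⟨D.hasAtomicMeasure_iff_eq hk hpos hτ, fun hne => ?_⟩
        exact D.hasAtomicMeasure_of_lt_add_sqrt hk hpos hτ
          (lt_of_le_of_ne (D.le_add_sqrt hk hpos h) fun he => hne (Or.inr he))
    · refine ⟨?_, fun h => ⟨fun h => absurd h hne2, fun _ => ?_⟩⟩
      · tfae_have 1 → 3 := fun h => by
          obtain ⟨hflat, heq, -⟩ := singular_of_hasMeasure hk2 hpos h
          exact ⟨h.isPPSD, Or.inr ⟨hk2, heq.le.trans (le_add_of_nonneg_right (Real.sqrt_nonneg _)),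
            Or.inr hflat⟩⟩
        tfae_have 3 → 2 := by
          rintro ⟨hP, ⟨h, -⟩ | ⟨-, -, h | h⟩⟩
          · exact absurd h hne2
          · refine absurd ?_ hpos
            have := posDef_hankel_iff.1 h
            rwa [(by omega : k - 2 + 1 = k - 1)] at this
          · obtain ⟨hσ, hτ, p₀, p₁, p₂, D⟩ := FlatRanks.gapData hk2 h
            rw [hσ, hτ] at D
            exact Or.inl (D.hasAtomicMeasure_of_singular hk hpos
              fun f hf => moment_sq_nonneg_of_degree_lt hk hP hf)
        tfae_have 2 → 1 := h21
        tfae_finish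
      · obtain ⟨hflat, heq, hat⟩ := singular_of_hasMeasure hk2 hpos h
        have hS : sTerm k β = uwTerm k β + √(schurTilde k β * schurCorner k β) := by
          rw [(hflat.gapData hk2).1, zero_mul, Real.sqrt_zero, add_zero, heq]
        exact ⟨iff_of_true hat (Or.inr hS), fun hne => absurd (Or.inr hS) hne⟩
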